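/- **Setting.** Let $(X,A,Y)$ be covariates $X\in\mathbb R^d$, a continuous treatment $A\in\mathcal A\subset\mathbb R$ and an outcome $Y\in\mathcal Y\subset[0,M]$ ($M<\infty$), with potential outcomes $Y(a)\in\mathcal Y$, $a\in\mathcal A$, jointly measurable in $a$ and the sample point. Let $f_0(a|x)$ be the conditional density (on $\mathcal A$) of $A$ given $X=x$, fix a regular conditional probability given $(A,X)$, concentrated on $\{A=a,X=x\}$ for every $a\in\mathcal A$ and almost every $x$, and let $f_0(y|a,x)$ be the density (on $\mathcal Y$) of $Y$ given $A=a,X=x$, for every $a\in\mathcal A$ and almost every $x$. Assume: 1. (Consistency) $Y=Y(a)$ whenever $A=a$. 2. (Unconfoundedness) $Y(a)\perp A\mid X$ for every $a\in\mathcal A$, in the sense that for almost every $x$ and all $a\in\mathcal A$ the law of $Y(a)$ given $A=a',X=x$ is the same for all $a'\in\mathcal A$. 3. (Positivity) there is $\epsilon>0$ with $f_0(a|x)\ge\epsilon$ for every $a\in\mathcal A$ and almost every $x$. 4. (Smoothness) $f_0(a|x)$ and $f_0(y|a,x)$ are three times differentiable in $a$ in the interior of $\mathcal A$; they and these derivatives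 are bounded there, uniformly in $(a,x)$, respectively $(y,a,x)$. Let $K:\mathbb R\to\mathbb R$ be a bounded measurable symmetric kernel, not necessarily non-negative, with $\int K=1$, $\int uK(u)\,du=0$ and $\int u^2|K(u)|\,du<\infty$, and put $K_h(x)=\frac1hK(\frac xh)$. Let $\alpha>0$ and let $\pi$ be a measurable policy that stays away from the boundary of $\mathcal A$: for some $\delta>0$, $(\pi(X)-\delta,\pi(X)+\delta)\subset\mathcal A$ almost surely. Assume that for almost every $x$ and almost every $y\in\mathcal Y$, $\partial^2_{aa}f_0(y|\pi(x),x)=0$ wherever $f_0(y|\pi(x),x)=0$ (for instance because $f_0(y|a,x)>0$ on $\mathcal Y$); the quotient below is read as $0$ there. For i.i.d. copies $(X_i,A_i,Y_i)$ of $(X,A,Y)$ let $$\hat W_N^h(\pi,\alpha)=\frac{\frac1N\sum_{i=1}^N\frac{K_h(\pi(X_i)-A_i)}{f_0(A_i|X_i)}e^{-Y_i/\alpha}}{\frac1N\sum_{i=1}^N\frac{K_h(\pi(X_i)-A_i)}{f_0(A_i|X_i)}}.$$ **Theorem.** Let $N\to\infty$ and let $h=h_N>0$ satisfy $h\to0$,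 $Nh\to\infty$ and $Nh^5\to C\in[0,\infty)$. Then $$\sqrt{Nh}\Big(\hat W_N^h(\pi,\alpha)-\mathbb E\big[e^{-Y(\pi(X))/\alpha}\big]-B_\pi(\alpha)h^2\Big)\xrightarrow{d}\mathcal N(0,\mathbb V_\pi(\alpha)),$$ where $$B_\pi(\alpha)=\frac{\int u^2K(u)\,du}{2}\;\mathbb E\Big[\mathbb E\Big[e^{-Y/\alpha}\,\frac{\partial^2_{aa}f_0(Y|\pi(X),X)}{f_0(Y|\pi(X),X)}\,\Big|\,A=\pi(X),X\Big]\Big],$$ $$\mathbb V_\pi(\alpha)=\Big(\int K(u)^2du\Big)\Big\{\mathbb E\Big[\mathbb E\Big[\tfrac{e^{-2Y/\alpha}}{f_0(\pi(X)|X)}\Big|A=\pi(X),X\Big]\Big]+\mathbb E\Big[\tfrac1{f_0(\pi(X)|X)}\Big]\big(\mathbb E[e^{-Y(\pi(X))/\alpha}]\big)^2-2\,\mathbb E\Big[\mathbb E\Big[\tfrac{e^{-Y/\alpha}}{f_0(\pi(X)|X)}\Big|A=\pi(X),X\Big]\Big]\mathbb E[e^{-Y(\pi(X))/\alpha}]\Big\};$$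 all these expectations exist and $\mathbb V_\pi(\alpha)\ge0$. -/

import Mathlib

open MeasureTheory ProbabilityTheory Filter Topology

/-- The objects of a causal model with a continuous treatment, on a sample space `Ω`:
covariates `X` in `ℝ^d`, treatment `A`, outcome `Y`, potential outcomes `Ypot a` (written `Y(a)`),
the treatment set `𝒜`, the outcome set `𝒴`, the conditional densities `fA a x = f₀(a|x)` and
`fY y a x = f₀(y|a,x)`, and the conditional probabilities
`condP (a, x) = ℙ₀(· | A = a, X = x)`. -/
structure CausalModel (Ω : Type*) [MeasurableSpace Ω] (d : ℕ) where
  X : Ω → EuclideanSpace ℝ (Fin d)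
  A : Ω → ℝ
  Y : Ω → ℝ
  Ypot : ℝ → Ω → ℝ
  𝒜 : Set ℝ
  𝒴 : Set ℝ
  fA : ℝ → EuclideanSpace ℝ (Fin d) → ℝ
  fY : ℝ → ℝ → EuclideanSpace ℝ (Fin d) → ℝ
  condP : Kernel (ℝ × EuclideanSpace ℝ (Fin d)) Ω

/-- `f` is three times differentiable at every point of the interior of `s`, and `f` and its
first three derivatives are bounded there by `C`. -/
def ThriceDiffBounded (f : ℝ → ℝ) (s : Set ℝ) (C : ℝ) : Prop :=
  ∀ a ∈ interior s,
    (∀ k < 3, DifferentiableAt ℝ (iteratedDeriv k f) a) ∧ ∀ k ≤ 3, |iteratedDeriv k f a| ≤ C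

/-- The standing assumptions on the model, for the underlying probability measure `P`. -/
structure CausalModel.Assumptions {Ω : Type*} [MeasurableSpace Ω] {d : ℕ}
    (m : CausalModel Ω d) (P : Measure Ω) : Prop where
  -- measurability
  measurable_X : Measurable m.X
  measurable_A : Measurable m.A
  measurable_Y : Measurable m.Y
  measurable_Ypot : Measurable (fun p : ℝ × Ω => m.Ypot p.1 p.2)
  measurableSet_𝒜 : MeasurableSet m.𝒜
  measurableSet_𝒴 : MeasurableSet m.𝒴
  measurable_fA : Measurable (fun p : ℝ × EuclideanSpace ℝ (Fin d) => m.fA p.1 p.2)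
  measurable_fY : Measurable (fun p : ℝ × ℝ × EuclideanSpace ℝ (Fin d) => m.fY p.1 p.2.1 p.2.2)
  -- ranges; outcomes are non-negative and bounded
  treatment_mem : ∀ᵐ ω ∂P, m.A ω ∈ m.𝒜
  outcome_mem : ∀ᵐ ω ∂P, m.Y ω ∈ m.𝒴
  potential_mem : ∀ a ∈ m.𝒜, ∀ᵐ ω ∂P, m.Ypot a ω ∈ m.𝒴
  bounded_outcome : ∃ M > 0, m.𝒴 ⊆ Set.Icc 0 M
  -- `condP` is a regular conditional probability of `P` given `(A, X)`
  markov_condP : IsMarkovKernel m.condP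
  disintegration : (P.map (fun ω => (m.A ω, m.X ω))).bind m.condP = P
  concentrated : ∀ᵐ x ∂(P.map m.X), ∀ a ∈ m.𝒜,
    ∀ᵐ ω ∂(m.condP (a, x)), m.A ω = a ∧ m.X ω = x
  -- `fA a x` is the density of `A` given `X = x`
  fA_nonneg : ∀ a x, 0 ≤ m.fA a x
  fA_density : P.map (fun ω => (m.X ω, m.A ω)) =
    ((P.map m.X).prod (volume.restrict m.𝒜)).withDensity
      (fun p => ENNReal.ofReal (m.fA p.2 p.1))
  -- `fY y a x` is the density of `Y` given `A = a` and `X = x`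
  fY_nonneg : ∀ y a x, 0 ≤ m.fY y a x
  fY_density : ∀ᵐ x ∂(P.map m.X), ∀ a ∈ m.𝒜,
    (m.condP (a, x)).map m.Y =
      (volume.restrict m.𝒴).withDensity (fun y => ENNReal.ofReal (m.fY y a x))
  -- consistency: if `A = a`, then `Y = Y(a)`
  consistency : ∀ ω, ∀ a ∈ m.𝒜, m.A ω = a → m.Y ω = m.Ypot a ω
  -- unconfoundedness: given `X = x` and `A = a'`, the law of `Y(a)` does not depend on `a'`
  unconfoundedness : ∀ᵐ x ∂(P.map m.X), ∀ a ∈ m.𝒜, ∀ a' ∈ m.𝒜, ∀ a'' ∈ m.𝒜,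
    (m.condP (a', x)).map (m.Ypot a) = (m.condP (a'', x)).map (m.Ypot a)
  -- positivity
  positivity : ∃ ε > 0, ∀ a ∈ m.𝒜, ∀ᵐ x ∂(P.map m.X), ε ≤ m.fA a x
  -- smoothness of the densities in the treatment, uniformly
  smooth_fA : ∃ C : ℝ, ∀ᵐ x ∂(P.map m.X), ThriceDiffBounded (fun a => m.fA a x) m.𝒜 C
  smooth_fY : ∃ C : ℝ, ∀ᵐ x ∂(P.map m.X), ∀ y ∈ m.𝒴,
    ThriceDiffBounded (fun a => m.fY y a x) m.𝒜 C

/-- A bounded second-order kernel function (with finite second moment, not necessarily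
non-negative). -/
structure IsSecondOrderKernel (K : ℝ → ℝ) : Prop where
  measurable : Measurable K
  bounded : ∃ M, ∀ u, |K u| ≤ M
  symmetric : ∀ u, K (-u) = K u
  integrable : Integrable K
  integrable_sq_mul : Integrable (fun u => u ^ 2 * K u)
  integral_eq_one : ∫ u, K u = 1
  integral_mul_eq_zero : ∫ u, u * K u = 0

/-- The scaled kernel `K_h(x) = K(x / h) / h`. -/
noncomputable def scaledKernel (K : ℝ → ℝ) (h x : ℝ) : ℝ := 1 / h * K (x / h)

namespace CausalModel

variable {Ω : Type*} [MeasurableSpace Ω] {d : ℕ}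

/-- The weight `K_h(π(x) - a) / f₀(a|x)`. -/
noncomputable def weight (m : CausalModel Ω d) (K : ℝ → ℝ) (π : EuclideanSpace ℝ (Fin d) → ℝ)
    (h : ℝ) (x : EuclideanSpace ℝ (Fin d)) (a : ℝ) : ℝ :=
  scaledKernel K h (π x - a) / m.fA a x

/-- The inverse probability weighting estimator of a sample of size `N`. -/
noncomputable def Wbar (m : CausalModel Ω d) (K : ℝ → ℝ) (π : EuclideanSpace ℝ (Fin d) → ℝ)
    (α h : ℝ) (N : ℕ) (x : ℕ → EuclideanSpace ℝ (Fin d)) (a y : ℕ → ℝ) : ℝ :=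
  1 / (N : ℝ) * ∑ i ∈ Finset.range N, m.weight K π h (x i) (a i) * Real.exp (-y i / α)

/-- The normalization factor of a sample of size `N`. -/
noncomputable def S (m : CausalModel Ω d) (K : ℝ → ℝ) (π : EuclideanSpace ℝ (Fin d) → ℝ)
    (h : ℝ) (N : ℕ) (x : ℕ → EuclideanSpace ℝ (Fin d)) (a : ℕ → ℝ) : ℝ :=
  1 / (N : ℝ) * ∑ i ∈ Finset.range N, m.weight K π h (x i) (a i)

/-- The self-normalized inverse probability weighting estimator. -/
noncomputable def What (m : CausalModel Ω d) (K : ℝ → ℝ) (π : EuclideanSpace ℝ (Fin d) → ℝ)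
    (α h : ℝ) (N : ℕ) (x : ℕ → EuclideanSpace ℝ (Fin d)) (a y : ℕ → ℝ) : ℝ :=
  m.Wbar K π α h N x a y / m.S K π h N x a

/-- The target `𝔼[exp(-Y(π(X)) / α)]`. -/
noncomputable def target (m : CausalModel Ω d) (P : Measure Ω)
    (π : EuclideanSpace ℝ (Fin d) → ℝ) (α : ℝ) : ℝ :=
  ∫ ω, Real.exp (-m.Ypot (π (m.X ω)) ω / α) ∂P

/-- `𝔼[g(X, Y) | A = π(x), X = x]`. -/
noncomputable def condMean (m : CausalModel Ω d) (π : EuclideanSpace ℝ (Fin d) → ℝ)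
    (g : EuclideanSpace ℝ (Fin d) → ℝ → ℝ) (x : EuclideanSpace ℝ (Fin d)) : ℝ :=
  ∫ ω, g x (m.Y ω) ∂(m.condP (π x, x))

/-- `𝔼[𝔼[g(X, Y) | A = π(X), X]]`. -/
noncomputable def iterMean (m : CausalModel Ω d) (P : Measure Ω)
    (π : EuclideanSpace ℝ (Fin d) → ℝ) (g : EuclideanSpace ℝ (Fin d) → ℝ → ℝ) : ℝ :=
  ∫ ω, m.condMean π g (m.X ω) ∂P

/-- Both expectations in `𝔼[𝔼[g(X, Y) | A = π(X), X]]` exist. -/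
def IterIntegrable (m : CausalModel Ω d) (P : Measure Ω)
    (π : EuclideanSpace ℝ (Fin d) → ℝ) (g : EuclideanSpace ℝ (Fin d) → ℝ → ℝ) : Prop :=
  (∀ᵐ ω ∂P, Integrable (fun ω' => g (m.X ω) (m.Y ω')) (m.condP (π (m.X ω), m.X ω))) ∧
    Integrable (fun ω => m.condMean π g (m.X ω)) P

/-- `exp(-y/α) ∂²ₐ f₀(y|π(x),x) / f₀(y|π(x),x)`. -/
noncomputable def biasIntegrand (m : CausalModel Ω d) (π : EuclideanSpace ℝ (Fin d) → ℝ) (α : ℝ)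
    (x : EuclideanSpace ℝ (Fin d)) (y : ℝ) : ℝ :=
  Real.exp (-y / α) * (iteratedDeriv 2 (fun a => m.fY y a x) (π x) / m.fY y (π x) x)

/-- `exp(-c y/α) / f₀(π(x)|x)`. -/
noncomputable def varIntegrand (m : CausalModel Ω d) (π : EuclideanSpace ℝ (Fin d) → ℝ) (α c : ℝ)
    (x : EuclideanSpace ℝ (Fin d)) (y : ℝ) : ℝ :=
  Real.exp (-(c * y) / α) / m.fA (π x) x

/-- The bias coefficient `B_π(α)`. -/
noncomputable def bias (m : CausalModel Ω d) (P : Measure Ω) (K : ℝ → ℝ)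
    (π : EuclideanSpace ℝ (Fin d) → ℝ) (α : ℝ) : ℝ :=
  (∫ u, u ^ 2 * K u) / 2 * m.iterMean P π (m.biasIntegrand π α)

/-- The asymptotic variance `𝕍_π(α)`. -/
noncomputable def asymVar (m : CausalModel Ω d) (P : Measure Ω) (K : ℝ → ℝ)
    (π : EuclideanSpace ℝ (Fin d) → ℝ) (α : ℝ) : ℝ :=
  (∫ u, K u ^ 2) *
    (m.iterMean P π (m.varIntegrand π α 2)
      + (∫ ω, 1 / m.fA (π (m.X ω)) (m.X ω) ∂P) * m.target P π α ^ 2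
      - 2 * m.iterMean P π (m.varIntegrand π α 1) * m.target P π α)

end CausalModel

/-!
# Asymptotic normality of the self-normalized kernel weighting estimator

Let `w = K_h(π(X) - A) / f₀(A|X)` be the weight, `θ` the target, `B` the bias coefficient and `S` the
mean of the weights over the sample. The estimation error, centered at its bias, is a quotient
whose numerator is a mean of i.i.d. terms:
`Ŵ - θ - B h² = S⁻¹ · (1/N) ∑ wᵢ (exp(-Yᵢ/α) - θ - B h²)` wherever `S ≠ 0`.
It is therefore enough to show that `S → 1` in probability and that `√(Nh)` times the numerator is
asymptotically normal (`tendstoInDistribution_of_eq_div`, a form of Slutsky's theorem).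

Both facts come from one central limit theorem for arrays that are i.i.d. in each row
(`tendstoInDistribution_sum_of_bounded_rows`). The terms of the rows are bounded by a multiple of
`(Nh)^(-1/2) → 0`, so the characteristic function of a row is determined by two limits: the total
mean and the total second moment. With limiting variance `0` the same theorem gives `S → 1`.

The two limits are computed by conditioning on the covariates. Weighting by `1 / f₀` turns the law
of the treatment into Lebesgue measure (`integral_weighted_eq`), so moments of `w ψ(Y)` are kernel
smoothers of `a ↦ 𝔼[ψ(Y) | A = a, X]` at `a = π(X)`.

* First moments: the kernel is symmetric, so only the symmetric differences of the conditional mean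
  at `π(X)` enter, and these have an expansion with error `O(|t|³)` near `0`. As `∫ |u|³ |K(u)| du`
  may be infinite, the error is truncated to a multiple of `t² min(|t|, 1)`; integrated against the
  kernel it is `o(h²)`, uniformly in the covariates (`abs_smooth_sub_le`,
  `exists_abs_integral_weight_sub_le`). Since `√(Nh) h² = √(N h⁵)` is bounded, `o(h²)` suffices.
* Second moments: `h 𝔼[w² ψ(Y)]` converges by dominated convergence, by continuity of the conditional
  mean and of `f₀` at `π(X)` (`tendsto_mul_integral_weight_sq`).

Identification of `θ` uses consistency and unconfoundedness (`ae_map_potential_policy`), and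
`asymVar_eq` shows that the asymptotic variance is the integral of a square.

Properties of the model at `X` and `π(X)` are stated for almost every sample point rather than for
almost every value of `X`: the set of `x` with `Metric.ball (π x) δ ⊆ 𝒜` need not be measurable.
-/

/-! ### A central limit theorem for bounded row-wise i.i.d. arrays -/

/-- Second-order expansion of the characteristic function of a bounded random variable, with an
error controlled by its second moment. -/
lemma norm_charFun_sub_le_of_bounded {Ω : Type*} [MeasurableSpace Ω] {P : Measure Ω}
    [IsProbabilityMeasure P] {Z : Ω → ℝ} (hZ : AEMeasurable Z P) {e : ℝ}
    (hb : ∀ᵐ ω ∂P, |Z ω| ≤ e) (t : ℝ) :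
    ‖charFun (P.map Z) t - (1 + t * (∫ ω, Z ω ∂P : ℝ) * Complex.I
        - t ^ 2 / 2 * (∫ ω, Z ω ^ 2 ∂P : ℝ))‖
      ≤ |t| ^ 3 * e * Real.exp (|t| * e) * ∫ ω, Z ω ^ 2 ∂P := by
  have hZi : Integrable Z P := .of_bound hZ.aestronglyMeasurable e hb
  have hZ2 : Integrable (fun ω => Z ω ^ 2) P := by
    refine .of_bound (hZ.pow_const 2).aestronglyMeasurable (e ^ 2) ?_
    filter_upwards [hb] with ω hω
    rw [Real.norm_eq_abs, abs_pow]
    gcongr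
  have hexp : Integrable (fun ω => Complex.exp (t * Z ω * Complex.I)) P := by
    refine .of_bound (by fun_prop) 1 (ae_of_all _ fun ω => ?_)
    rw [← Complex.ofReal_mul, Complex.norm_exp_ofReal_mul_I]
  have e1 : Integrable (fun ω => (t : ℂ) * (Z ω : ℂ) * Complex.I) P :=
    (hZi.ofReal.const_mul _).mul_const _
  have e2 : Integrable (fun ω => (t : ℂ) ^ 2 / 2 * ((Z ω ^ 2 : ℝ) : ℂ)) P :=
    hZ2.ofReal.const_mul _
  have heq : charFun (P.map Z) t - (1 + t * (∫ ω, Z ω ∂P : ℝ) * Complex.I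
        - t ^ 2 / 2 * (∫ ω, Z ω ^ 2 ∂P : ℝ))
      = ∫ ω, (Complex.exp (t * Z ω * Complex.I)
        - (1 + t * Z ω * Complex.I - t ^ 2 / 2 * ((Z ω ^ 2 : ℝ) : ℂ))) ∂P := by
    have e3 : Integrable (fun ω => (1 : ℂ) + t * Z ω * Complex.I) P :=
      (integrable_const _).add e1
    have e4 : Integrable (fun ω => (1 : ℂ) + t * Z ω * Complex.I
        - t ^ 2 / 2 * ((Z ω ^ 2 : ℝ) : ℂ)) P := e3.sub e2
    rw [charFun_apply_real, integral_map hZ (by fun_prop), integral_sub hexp e4,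
      integral_sub e3 e2, integral_add (integrable_const _) e1, integral_mul_const,
      integral_const_mul, integral_const_mul, integral_complex_ofReal, integral_complex_ofReal]
    simp
  rw [heq, ← integral_const_mul]
  refine (norm_integral_le_integral_norm _).trans (integral_mono_ae ?_ (hZ2.const_mul _) ?_)
  · exact (hexp.sub (((integrable_const _).add e1).sub e2)).norm
  filter_upwards [hb] with ω hω
  have h3 := Complex.norm_exp_sub_sum_le_norm_mul_exp (t * Z ω * Complex.I) 3
  have hn : ‖(t * Z ω * Complex.I : ℂ)‖ = |t| * |Z ω| := by simp
  have hs : ∑ m ∈ Finset.range 3, (t * Z ω * Complex.I : ℂ) ^ m / (m.factorial : ℂ)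
      = 1 + t * Z ω * Complex.I - t ^ 2 / 2 * ((Z ω ^ 2 : ℝ) : ℂ) := by
    simp only [Finset.sum_range_succ, Finset.sum_range_zero, Nat.factorial, mul_pow,
      Complex.I_sq]
    push_cast
    ring
  rw [hn, hs] at h3
  refine h3.trans ?_
  have he : 0 ≤ e := (abs_nonneg _).trans hω
  calc (|t| * |Z ω|) ^ 3 * Real.exp (|t| * |Z ω|)
      = |t| ^ 3 * |Z ω| * Real.exp (|t| * |Z ω|) * Z ω ^ 2 := by
        rw [← sq_abs (Z ω)]; ring
    _ ≤ |t| ^ 3 * e * Real.exp (|t| * e) * Z ω ^ 2 := by gcongr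

/-- A central limit theorem for arrays `ξ N (W i)`, `i < N`, that are i.i.d. in each row and bounded
by constants tending to `0`. The summands need not be centered: their total mean has to vanish in
the limit, and their total second moment has to converge to the limiting variance `v`, which may
be `0`. -/
theorem tendstoInDistribution_sum_of_bounded_rows {Ω Ω' 𝓧 : Type*} [MeasurableSpace Ω]
    [MeasurableSpace Ω'] [MeasurableSpace 𝓧] {P : Measure Ω} [IsProbabilityMeasure P]
    {P' : Measure Ω'} [IsProbabilityMeasure P'] {W : ℕ → Ω' → 𝓧} {V : Ω → 𝓧} {ξ : ℕ → 𝓧 → ℝ}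
    {e : ℕ → ℝ} {v : ℝ} (hindep : iIndepFun W P') (hident : ∀ i, IdentDistrib (W i) V P' P)
    (hξ : ∀ N, Measurable (ξ N)) (he : Tendsto e atTop (𝓝 0))
    (hb : ∀ N, ∀ᵐ ω ∂P, |ξ N (V ω)| ≤ e N)
    (hmean : Tendsto (fun N : ℕ => (N : ℝ) * ∫ ω, ξ N (V ω) ∂P) atTop (𝓝 0))
    (hvar : Tendsto (fun N : ℕ => (N : ℝ) * ∫ ω, ξ N (V ω) ^ 2 ∂P) atTop (𝓝 v)) :
    TendstoInDistribution (fun (N : ℕ) ω => ∑ i ∈ Finset.range N, ξ N (W i ω)) atTop id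
      (fun _ => P') (gaussianReal 0 v.toNNReal) := by
  have hv : 0 ≤ v := ge_of_tendsto' hvar fun N =>
    mul_nonneg N.cast_nonneg (integral_nonneg fun _ => sq_nonneg _)
  have hmeas N i : AEMeasurable (fun ω => ξ N (W i ω)) P' :=
    (hξ N).comp_aemeasurable (hident i).aemeasurable_fst
  refine ⟨fun N => Finset.aemeasurable_fun_sum _ fun i _ => hmeas N i, aemeasurable_id, ?_⟩
  refine ProbabilityMeasure.tendsto_of_tendsto_charFun fun t => ?_
  have hchar N : charFun (P'.map fun ω => ∑ i ∈ Finset.range N, ξ N (W i ω)) t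
      = (charFun (P.map fun ω => ξ N (V ω)) t) ^ N := by
    have hi : iIndepFun (fun i ω => ξ N (W i ω)) P' := hindep.comp (fun _ => ξ N) fun _ => hξ N
    rw [(hi.restrict _).charFun_map_fun_finsetSum_eq_prod fun i _ => hmeas N i]
    have hid i : P'.map (fun ω => ξ N (W i ω)) = P.map fun ω => ξ N (V ω) :=
      ((hident i).comp (hξ N)).map_eq
    simp [hid]
  have hlim : Tendsto (fun N : ℕ =>
      (N : ℂ) * (charFun (P.map fun ω => ξ N (V ω)) t - 1)) atTop
      (𝓝 ((t * (0 : ℝ) * Complex.I - t ^ 2 / 2 * v : ℂ))) := by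
    have hmain : Tendsto (fun N : ℕ => (t * (((N : ℝ) * ∫ ω, ξ N (V ω) ∂P : ℝ) : ℂ) * Complex.I
        - t ^ 2 / 2 * (((N : ℝ) * ∫ ω, ξ N (V ω) ^ 2 ∂P : ℝ) : ℂ))) atTop
        (𝓝 ((t * (0 : ℝ) * Complex.I - t ^ 2 / 2 * v : ℂ))) := by
      have c1 := (Complex.continuous_ofReal.tendsto _).comp hmean
      have c2 := (Complex.continuous_ofReal.tendsto _).comp hvar
      exact ((c1.const_mul (t : ℂ)).mul_const _).sub (c2.const_mul _)
    refine hmain.congr_dist ?_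
    have hbd : Tendsto (fun N : ℕ => |t| ^ 3 * e N * Real.exp (|t| * e N)
        * ((N : ℝ) * ∫ ω, ξ N (V ω) ^ 2 ∂P)) atTop (𝓝 0) := by
      have := ((he.const_mul (|t| ^ 3)).mul
        ((Real.continuous_exp.tendsto _).comp (he.const_mul |t|))).mul hvar
      simpa using this
    refine squeeze_zero (fun _ => dist_nonneg) (fun N => ?_) hbd
    have hVm : AEMeasurable (fun ω => ξ N (V ω)) P :=
      (hξ N).comp_aemeasurable (hident 0).aemeasurable_snd
    have := norm_charFun_sub_le_of_bounded hVm (hb N) t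
    rw [dist_comm, dist_eq_norm]
    calc _ = ‖(N : ℂ) * (charFun (P.map fun ω => ξ N (V ω)) t
            - (1 + t * (∫ ω, ξ N (V ω) ∂P : ℝ) * Complex.I
              - t ^ 2 / 2 * (∫ ω, ξ N (V ω) ^ 2 ∂P : ℝ)))‖ := by
          congr 1; push_cast; ring
      _ ≤ N * (|t| ^ 3 * e N * Real.exp (|t| * e N) * ∫ ω, ξ N (V ω) ^ 2 ∂P) := by
          rw [norm_mul, Complex.norm_natCast]
          exact mul_le_mul_of_nonneg_left this N.cast_nonneg
      _ = _ := by ring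
  have := Complex.tendsto_one_add_pow_exp_of_tendsto hlim
  simp only [ProbabilityMeasure.coe_mk, hchar, Measure.map_id, charFun_gaussianReal]
  convert this using 2
  · ring
  · simp [hv]
    ring_nf

/-- Convergence in distribution to a point mass is convergence in probability. -/
lemma tendstoInMeasure_of_tendstoInDistribution_zero {Ω' : Type*} [MeasurableSpace Ω']
    {P' : Measure Ω'} [IsProbabilityMeasure P'] {X : ℕ → Ω' → ℝ}
    (hX : TendstoInDistribution X atTop id (fun _ => P') (gaussianReal 0 (0 : ℝ).toNNReal)) :
    TendstoInMeasure P' X atTop fun _ => 0 := by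
  rw [tendstoInMeasure_iff_norm]
  intro ε hε
  have hF : IsClosed {x : ℝ | ε ≤ ‖x‖} := isClosed_le continuous_const continuous_norm
  have h0 : (gaussianReal 0 (0 : ℝ).toNNReal).map id {x : ℝ | ε ≤ ‖x‖} = 0 := by
    simp [hε]
  have key := ProbabilityMeasure.tendsto_measure_of_null_frontier_of_tendsto' hX.tendsto
    (E := {x : ℝ | ε ≤ ‖x‖}) (measure_mono_null hF.frontier_subset h0)
  simp only [ProbabilityMeasure.coe_mk] at key
  rw [h0] at key
  refine key.congr fun n => ?_
  rw [Measure.map_apply_of_aemeasurable (hX.forall_aemeasurable n) hF.measurableSet]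
  simp

/-! ### Second-order expansion of a density in the treatment -/

section Taylor

variable {f : ℝ → ℝ} {s : Set ℝ} {C p δ t : ℝ}

lemma ThriceDiffBounded.hasDerivAt (hf : ThriceDiffBounded f s C) {a : ℝ} (ha : a ∈ interior s)
    {k : ℕ} (hk : k < 3) : HasDerivAt (iteratedDeriv k f) (iteratedDeriv (k + 1) f a) a := by
  rw [iteratedDeriv_succ]
  exact ((hf a ha).1 k hk).hasDerivAt

lemma ThriceDiffBounded.abs_iteratedDeriv_le (hf : ThriceDiffBounded f s C)
    (hs : Metric.ball p δ ⊆ s) (ht : |t| < δ) {k : ℕ} (hk : k ≤ 3) : |iteratedDeriv k f (p + t)| ≤ C :=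
  (hf _ (interior_maximal hs Metric.isOpen_ball (by simpa [Real.dist_eq] using ht))).2 k hk

lemma ThriceDiffBounded.abs_iteratedDeriv_sub_le (hf : ThriceDiffBounded f s C)
    (hs : Metric.ball p δ ⊆ s) (ht : |t| < δ) {k : ℕ} (hk : k < 3) :
    |iteratedDeriv k f (p + t) - iteratedDeriv k f p| ≤ C * |t| := by
  have hi : Metric.ball p δ ⊆ interior s := interior_maximal hs Metric.isOpen_ball
  have := (convex_ball p δ).norm_image_sub_le_of_norm_hasDerivWithin_le (C := C)
    (f := iteratedDeriv k f) (f' := iteratedDeriv (k + 1) f) (x := p) (y := p + t)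
    (fun x hx => (hf.hasDerivAt (hi hx) hk).hasDerivWithinAt)
    (fun x hx => (hf x (hi hx)).2 (k + 1) (by omega))
    (by simpa using (abs_nonneg t).trans_lt ht) (by simpa [Real.dist_eq] using ht)
  simpa using this

/-- The symmetric second-order Taylor expansion; the first derivative cancels. -/
lemma ThriceDiffBounded.abs_symm_sub_le (hf : ThriceDiffBounded f s C)
    (hs : Metric.ball p δ ⊆ s) (ht : |t| < δ) :
    |f (p + t) + f (p - t) - 2 * f p - t ^ 2 * iteratedDeriv 2 f p| ≤ 2 * C * |t| ^ 3 := by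
  have hδ : 0 < δ := (abs_nonneg t).trans_lt ht
  have hC : 0 ≤ C := (abs_nonneg _).trans (hf.abs_iteratedDeriv_le (t := 0) hs
    (by simpa using hδ) (k := 0) (by norm_num))
  set S : Set ℝ := Set.Icc (-|t|) |t| with hS
  have hSc : Convex ℝ S := convex_Icc _ _
  have h0 : (0 : ℝ) ∈ S := by simp [hS]
  have htS : t ∈ S := ⟨neg_abs_le t, le_abs_self t⟩
  have hin {u : ℝ} (hu : u ∈ S) : |u| ≤ |t| := abs_le.2 hu
  have hi {u : ℝ} (hu : |u| ≤ |t|) : p + u ∈ interior s :=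
    interior_maximal hs Metric.isOpen_ball (by simpa [Real.dist_eq] using hu.trans_lt ht)
  have hplus {u : ℝ} (hu : u ∈ S) {k : ℕ} (hk : k < 3) :
      HasDerivAt (fun u => iteratedDeriv k f (p + u)) (iteratedDeriv (k + 1) f (p + u)) u := by
    simpa using (hf.hasDerivAt (hi (hin hu)) hk).comp_const_add p u
  have hminus {u : ℝ} (hu : u ∈ S) {k : ℕ} (hk : k < 3) :
      HasDerivAt (fun u => iteratedDeriv k f (p - u)) (-iteratedDeriv (k + 1) f (p - u)) u := by
    have := hf.hasDerivAt (hi (u := -u) (by simpa using hin hu)) hk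
    rw [← sub_eq_add_neg] at this
    exact this.comp_const_sub p u
  have h2 {u : ℝ} (hu : u ∈ S) :
      ‖iteratedDeriv 2 f (p + u) + iteratedDeriv 2 f (p - u) - 2 * iteratedDeriv 2 f p‖
        ≤ 2 * C * |t| := by
    have b1 := hf.abs_iteratedDeriv_sub_le hs ((hin hu).trans_lt ht) (k := 2) (by norm_num)
    have b2 := hf.abs_iteratedDeriv_sub_le hs (t := -u)
      (by simpa using (hin hu).trans_lt ht) (k := 2) (by norm_num)
    rw [← sub_eq_add_neg, abs_neg] at b2
    have b3 : C * |u| ≤ C * |t| := mul_le_mul_of_nonneg_left (hin hu) hC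
    rw [Real.norm_eq_abs]
    calc _ = |(iteratedDeriv 2 f (p + u) - iteratedDeriv 2 f p)
          + (iteratedDeriv 2 f (p - u) - iteratedDeriv 2 f p)| := by congr 1; ring
      _ ≤ _ := abs_add_le _ _
      _ ≤ 2 * C * |t| := by linarith
  have h1 {u : ℝ} (hu : u ∈ S) :
      ‖iteratedDeriv 1 f (p + u) - iteratedDeriv 1 f (p - u) - 2 * u * iteratedDeriv 2 f p‖
        ≤ 2 * C * |t| ^ 2 := by
    have := hSc.norm_image_sub_le_of_norm_hasDerivWithin_le (C := 2 * C * |t|)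
      (f := fun u => iteratedDeriv 1 f (p + u) - iteratedDeriv 1 f (p - u)
        - 2 * u * iteratedDeriv 2 f p)
      (f' := fun u => iteratedDeriv 2 f (p + u) + iteratedDeriv 2 f (p - u)
        - 2 * iteratedDeriv 2 f p) (x := 0) (y := u)
      (fun x hx => by
        have := ((hplus hx (k := 1) (by norm_num)).sub (hminus hx (k := 1) (by norm_num))).sub
          (((hasDerivAt_id x).const_mul 2).mul_const (iteratedDeriv 2 f p))
        refine HasDerivAt.hasDerivWithinAt ?_
        convert! this using 1
        simp)
      (fun x hx => h2 hx) h0 hu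
    simp only [add_zero, sub_zero, sub_self, mul_zero, zero_mul] at this
    refine this.trans ?_
    rw [Real.norm_eq_abs, pow_two, ← mul_assoc]
    exact mul_le_mul_of_nonneg_left (hin hu) (by positivity)
  have := hSc.norm_image_sub_le_of_norm_hasDerivWithin_le (C := 2 * C * |t| ^ 2)
    (f := fun u => iteratedDeriv 0 f (p + u) + iteratedDeriv 0 f (p - u)
      - 2 * f p - u ^ 2 * iteratedDeriv 2 f p)
    (f' := fun u => iteratedDeriv 1 f (p + u) - iteratedDeriv 1 f (p - u)
      - 2 * u * iteratedDeriv 2 f p) (x := 0) (y := t)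
    (fun x hx => by
      have := (((hplus hx (k := 0) (by norm_num)).add (hminus hx (k := 0) (by norm_num))).sub_const
        (2 * f p)).sub (((hasDerivAt_id x).pow 2).mul_const (iteratedDeriv 2 f p))
      refine HasDerivAt.hasDerivWithinAt ?_
      convert! this using 1
      simp [sub_eq_add_neg])
    (fun x hx => h1 hx) h0 htS
  simp only [iteratedDeriv_zero, add_zero, sub_zero, Real.norm_eq_abs] at this
  convert this using 1
  · congr 1; ring
  · ring

end Taylor

/-! ### Kernel smoothing -/

/-- The substitution `a = p - h u`. -/
lemma integral_scaled_mul_eq (k v : ℝ → ℝ) {h : ℝ} (hh : 0 < h) (p : ℝ) :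
    ∫ a, 1 / h * k ((p - a) / h) * v a = ∫ u, k u * v (p - h * u) := by
  have e1 := integral_sub_left_eq_self (fun t => 1 / h * k (t / h) * v (p - t)) volume p
  have e2 := Measure.integral_comp_mul_left (fun t => 1 / h * k (t / h) * v (p - t)) h
  simp only [sub_sub_cancel] at e1
  rw [e1]
  have e3 : ∫ t, 1 / h * k (t / h) * v (p - t)
      = h * ∫ x, 1 / h * k (h * x / h) * v (p - h * x) := by
    rw [e2, abs_of_pos (inv_pos.2 hh), smul_eq_mul, mul_inv_cancel_left₀ hh.ne']
  rw [e3, ← integral_const_mul]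
  refine integral_congr_ae (ae_of_all _ fun u => ?_)
  simp only
  rw [mul_div_cancel_left₀ u hh.ne']
  field_simp

lemma integrable_mul_comp_affine {k v : ℝ → ℝ} (hk : Integrable k) (hv : Measurable v) {B : ℝ}
    (hB : ∀ a, |v a| ≤ B) (p c : ℝ) : Integrable fun u => k u * v (p + c * u) :=
  hk.mul_bdd (c := B) (hv.comp (by fun_prop)).aestronglyMeasurable (ae_of_all _ fun u => hB _)

/-- The coefficient of `h ^ 2` in the remainder of the second-order expansion of a kernel
smoother. As only the second moment of the kernel is finite, the cubic Taylor remainder is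
truncated. -/
noncomputable def smoothingRemainder (K : ℝ → ℝ) (h : ℝ) : ℝ :=
  ∫ u, |K u| * (u ^ 2 * min |h * u| 1)

namespace IsSecondOrderKernel

variable {K : ℝ → ℝ}

lemma norm_smoothingRemainder_integrand_le (K : ℝ → ℝ) (h u : ℝ) :
    ‖|K u| * (u ^ 2 * min |h * u| 1)‖ ≤ ‖u ^ 2 * K u‖ := by
  have h0 : 0 ≤ min |h * u| 1 := le_min (abs_nonneg _) zero_le_one
  have h1 : min |h * u| 1 ≤ 1 := min_le_right _ _
  rw [Real.norm_eq_abs, Real.norm_eq_abs, abs_mul, abs_mul (u ^ 2), abs_mul (u ^ 2), abs_abs,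
    abs_of_nonneg h0, mul_comm |u ^ 2| |K u|]
  gcongr
  exact mul_le_of_le_one_right (abs_nonneg _) h1

lemma integrable_smoothingRemainder (hK : IsSecondOrderKernel K) (h : ℝ) :
    Integrable fun u => |K u| * (u ^ 2 * min |h * u| 1) := by
  have := hK.measurable
  exact hK.integrable_sq_mul.norm.mono' (by fun_prop)
    (ae_of_all _ fun u => norm_smoothingRemainder_integrand_le K h u)

lemma tendsto_smoothingRemainder (hK : IsSecondOrderKernel K) {h : ℕ → ℝ}
    (h_zero : Tendsto h atTop (𝓝 0)) :
    Tendsto (fun N => smoothingRemainder K (h N)) atTop (𝓝 0) := by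
  have hm := hK.measurable
  have := tendsto_integral_of_dominated_convergence (μ := volume)
    (F := fun N u => |K u| * (u ^ 2 * min |h N * u| 1)) (f := fun _ => (0 : ℝ))
    (fun u => ‖u ^ 2 * K u‖) (fun N => by fun_prop) hK.integrable_sq_mul.norm
    (fun N => ae_of_all _ fun u => norm_smoothingRemainder_integrand_le K (h N) u)
    (ae_of_all _ fun u => ?_)
  · rw [integral_zero] at this
    exact this
  · have h1 : Tendsto (fun N => |h N * u|) atTop (𝓝 0) := by
      simpa using (h_zero.mul_const u).abs
    have h2 := ((h1.min (tendsto_const_nhds (x := (1 : ℝ)))).const_mul (u ^ 2)).const_mul |K u|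
    rwa [min_eq_left zero_le_one, mul_zero, mul_zero] at h2

lemma integrable_sq (hK : IsSecondOrderKernel K) : Integrable fun u => K u ^ 2 := by
  obtain ⟨M, hM⟩ := hK.bounded
  have := hK.integrable.mul_bdd (c := M) hK.measurable.aestronglyMeasurable (ae_of_all _ hM)
  simpa only [pow_two] using this

/-- Second-order expansion of a kernel smoother. The remainder is uniform over the functions `v`
that share the bound `B` and the constant `L` in the symmetric expansion of `v` at `p`. -/
lemma abs_smooth_sub_le (hK : IsSecondOrderKernel K) {v : ℝ → ℝ} (hv : Measurable v)
    {B L δ D p h : ℝ} (hB : ∀ a, |v a| ≤ B) (hδ : 0 < δ) (hδ1 : δ ≤ 1) (hD : |D| ≤ L)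
    (hsymm : ∀ t, |t| < δ → |v (p + t) + v (p - t) - 2 * v p - t ^ 2 * D| ≤ L * |t| ^ 3)
    (hh : 0 < h) :
    |(∫ a, scaledKernel K h (p - a) * v a)
        - (v p + h ^ 2 * ((∫ u, u ^ 2 * K u) / 2 * D))|
      ≤ h ^ 2 * ((L + (2 * B / δ ^ 2 + L) / δ) * smoothingRemainder K h) := by
  set c := L + (2 * B / δ ^ 2 + L) / δ with hc
  have hL : 0 ≤ L := (abs_nonneg _).trans hD
  have hB0 : 0 ≤ B := (abs_nonneg _).trans (hB 0)
  have hbr t : |(v (p - t) + v (p + t)) / 2 - v p - t ^ 2 * (D / 2)|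
      ≤ c * (t ^ 2 * min |t| 1) := by
    rcases lt_or_ge |t| δ with ht | ht
    · rw [min_eq_left (ht.le.trans hδ1)]
      have e : (v (p - t) + v (p + t)) / 2 - v p - t ^ 2 * (D / 2)
          = (v (p + t) + v (p - t) - 2 * v p - t ^ 2 * D) / 2 := by ring
      rw [e, abs_div, abs_two]
      have hLc : L ≤ c := le_add_of_nonneg_right (by positivity)
      have h3 : t ^ 2 * |t| = |t| ^ 3 := by rw [← sq_abs]; ring
      have h4 : 0 ≤ L * |t| ^ 3 := by positivity
      calc _ ≤ L * |t| ^ 3 := by linarith [hsymm t ht]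
        _ ≤ c * |t| ^ 3 := by gcongr
        _ = c * (t ^ 2 * |t|) := by rw [h3]
    · -- Away from the centre the bracket is bounded by a multiple of `t ^ 2`.
      have hm : δ ≤ min |t| 1 := le_min ht hδ1
      have h2 : δ ^ 2 ≤ t ^ 2 := by rw [← sq_abs t]; gcongr
      have h1 : 2 * B ≤ 2 * B / δ ^ 2 * t ^ 2 := by
        rw [div_mul_eq_mul_div, le_div_iff₀ (by positivity)]
        gcongr
      have h3 : |t ^ 2 * (D / 2)| ≤ L * t ^ 2 := by
        rw [abs_mul, abs_of_nonneg (sq_nonneg t), abs_div, abs_two, mul_comm]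
        gcongr
        linarith [abs_nonneg D]
      have h4 : |(v (p - t) + v (p + t)) / 2 - v p| ≤ 2 * B := by
        have a1 := abs_le.1 (hB (p - t))
        have a2 := abs_le.1 (hB (p + t))
        have a3 := abs_le.1 (hB p)
        exact abs_le.2 ⟨by linarith [a1.1, a2.1, a3.2], by linarith [a1.2, a2.2, a3.1]⟩
      calc _ ≤ |(v (p - t) + v (p + t)) / 2 - v p| + |t ^ 2 * (D / 2)| := abs_sub _ _
        _ ≤ 2 * B / δ ^ 2 * t ^ 2 + L * t ^ 2 := add_le_add (h4.trans h1) h3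
        _ = (2 * B / δ ^ 2 + L) / δ * (t ^ 2 * δ) := by field_simp
        _ ≤ (2 * B / δ ^ 2 + L) / δ * (t ^ 2 * min |t| 1) := by gcongr
        _ ≤ c * (t ^ 2 * min |t| 1) := by
          have : 0 ≤ min |t| 1 := hδ.le.trans hm
          gcongr
          exact le_add_of_nonneg_left hL
  have i1 : Integrable fun u => K u * v (p - h * u) := by
    simpa [sub_eq_add_neg] using integrable_mul_comp_affine hK.integrable hv hB p (-h)
  have i2 : Integrable fun u => K u * v (p + h * u) :=
    integrable_mul_comp_affine hK.integrable hv hB p h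
  have hflip : ∫ u, K u * v (p - h * u) = ∫ u, K u * v (p + h * u) := by
    rw [← integral_neg_eq_self]
    refine integral_congr_ae (ae_of_all _ fun u => ?_)
    simp [hK.symmetric]
  have heq : (∫ a, scaledKernel K h (p - a) * v a) - (v p + h ^ 2 * ((∫ u, u ^ 2 * K u) / 2 * D))
      = ∫ u, K u * ((v (p - h * u) + v (p + h * u)) / 2 - v p - (h * u) ^ 2 * (D / 2)) := by
    have e u : K u * ((v (p - h * u) + v (p + h * u)) / 2 - v p - (h * u) ^ 2 * (D / 2))
        = ((K u * v (p - h * u) + K u * v (p + h * u)) / 2 - K u * v p)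
          - u ^ 2 * K u * (h ^ 2 * (D / 2)) := by ring
    have i3 := hK.integrable.mul_const (v p)
    have i4 := hK.integrable_sq_mul.mul_const (h ^ 2 * (D / 2))
    have i5 : Integrable fun u => (K u * v (p - h * u) + K u * v (p + h * u)) / 2 :=
      (i1.add i2).div_const 2
    have i6 : Integrable fun u =>
      (K u * v (p - h * u) + K u * v (p + h * u)) / 2 - K u * v p := i5.sub i3
    simp only [scaledKernel, e]
    rw [integral_scaled_mul_eq K v hh p, integral_sub i6 i4, integral_sub i5 i3,
      integral_div, integral_add i1 i2, integral_mul_const, integral_mul_const,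
      hK.integral_eq_one, ← hflip]
    ring
  rw [heq, smoothingRemainder, ← mul_assoc, ← integral_const_mul]
  rw [← Real.norm_eq_abs]
  refine norm_integral_le_of_norm_le ((hK.integrable_smoothingRemainder h).const_mul _)
    (ae_of_all _ fun u => ?_)
  rw [Real.norm_eq_abs, abs_mul]
  calc _ ≤ |K u| * (c * ((h * u) ^ 2 * min |h * u| 1)) := by gcongr; exact hbr (h * u)
    _ = _ := by ring

/-- Squared kernels concentrate at the point of continuity. -/
lemma tendsto_smooth_sq (hK : IsSecondOrderKernel K) {q : ℝ → ℝ} (hq : Measurable q) {B p : ℝ}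
    (hB : ∀ a, |q a| ≤ B) (hc : ContinuousAt q p) {h : ℕ → ℝ} (h_pos : ∀ N, 0 < h N)
    (h_zero : Tendsto h atTop (𝓝 0)) :
    Tendsto (fun N => ∫ a, 1 / h N * K ((p - a) / h N) ^ 2 * q a) atTop
      (𝓝 ((∫ u, K u ^ 2) * q p)) := by
  have hm := hK.measurable
  have heq N := integral_scaled_mul_eq (fun u => K u ^ 2) q (h_pos N) p
  simp only [heq]
  rw [← integral_mul_const]
  refine tendsto_integral_of_dominated_convergence (fun u => K u ^ 2 * B) (fun N => by fun_prop)
    (hK.integrable_sq.mul_const B) (fun N => ae_of_all _ fun u => ?_) (ae_of_all _ fun u => ?_)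
  · rw [Real.norm_eq_abs, abs_mul, abs_pow, sq_abs]
    exact mul_le_mul_of_nonneg_left (hB _) (sq_nonneg _)
  · have : Tendsto (fun N => p - h N * u) atTop (𝓝 p) := by
      simpa using (h_zero.mul_const u).const_sub p
    exact (hc.tendsto.comp this).const_mul _

lemma abs_smooth_sq_le (hK : IsSecondOrderKernel K) {q : ℝ → ℝ} {B p h : ℝ}
    (hB : ∀ a, |q a| ≤ B) (hh : 0 < h) :
    |∫ a, 1 / h * K ((p - a) / h) ^ 2 * q a| ≤ (∫ u, K u ^ 2) * B := by
  rw [integral_scaled_mul_eq (fun u => K u ^ 2) q hh p, ← integral_mul_const]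
  refine norm_integral_le_of_norm_le (f := fun u => K u ^ 2 * q (p - h * u))
    (hK.integrable_sq.mul_const B) (ae_of_all _ fun u => ?_)
  rw [Real.norm_eq_abs, abs_mul, abs_pow, sq_abs]
  exact mul_le_mul_of_nonneg_left (hB _) (sq_nonneg _)

end IsSecondOrderKernel

/-! ### Disintegration of the model -/

namespace CausalModel

variable {Ω : Type*} [MeasurableSpace Ω] {d : ℕ}

/-- The conditional mean `𝔼[ψ(Y) | A = a, X = x]`. -/
noncomputable def condMeanOutcome (m : CausalModel Ω d) (ψ : ℝ → ℝ) (a : ℝ)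
    (x : EuclideanSpace ℝ (Fin d)) : ℝ :=
  ∫ ω, ψ (m.Y ω) ∂(m.condP (a, x))

/-- The integral of `ψ` against the second treatment derivative of the outcome density. -/
noncomputable def integralDeriv2 (m : CausalModel Ω d) (ψ : ℝ → ℝ) (a : ℝ)
    (x : EuclideanSpace ℝ (Fin d)) : ℝ :=
  ∫ y in m.𝒴, ψ y * iteratedDeriv 2 (fun a => m.fY y a x) a

namespace Assumptions

variable {m : CausalModel Ω d} {P : Measure Ω}

lemma measurable_condMeanOutcome (hm : m.Assumptions P) {ψ : ℝ → ℝ} (hψ : Measurable ψ) :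
    Measurable fun q : ℝ × EuclideanSpace ℝ (Fin d) => m.condMeanOutcome ψ q.1 q.2 := by
  have := hm.markov_condP
  exact ((hψ.comp hm.measurable_Y).stronglyMeasurable.integral_kernel (κ := m.condP)).measurable

lemma abs_condMeanOutcome_le (hm : m.Assumptions P) {ψ : ℝ → ℝ} {B : ℝ} (hB : ∀ y, |ψ y| ≤ B)
    (a : ℝ) (x : EuclideanSpace ℝ (Fin d)) : |m.condMeanOutcome ψ a x| ≤ B := by
  have := hm.markov_condP
  refine (norm_integral_le_of_norm_le_const (f := fun ω => ψ (m.Y ω)) (C := B)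
    (ae_of_all _ fun ω => hB _)).trans ?_
  simp

/-- The disintegration of `P` along `(A, X)`. -/
lemma integral_eq_integral_condP (hm : m.Assumptions P) {f : Ω → ℝ} (hf : Measurable f)
    (hfi : Integrable f P) :
    ∫ ω, f ω ∂P = ∫ ω, ∫ ω', f ω' ∂(m.condP (m.A ω, m.X ω)) ∂P := by
  have := hm.markov_condP
  set κ : Kernel Unit (ℝ × EuclideanSpace ℝ (Fin d)) :=
    Kernel.const Unit (P.map fun ω => (m.A ω, m.X ω)) with hκ
  have hP : (m.condP ∘ₖ κ) () = P := by
    rw [Kernel.comp_apply, hκ, Kernel.const_apply]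
    exact hm.disintegration
  have := Kernel.integral_comp (η := m.condP) (κ := κ) (a := ()) (f := f) (by rwa [hP])
  rw [hP] at this
  rw [this, hκ, Kernel.const_apply,
    integral_map (hm.measurable_A.prodMk hm.measurable_X).aemeasurable
      hf.stronglyMeasurable.integral_kernel.aestronglyMeasurable]

lemma ae_concentrated (hm : m.Assumptions P) : ∀ᵐ ω ∂P, ∀ a ∈ m.𝒜,
    ∀ᵐ ω' ∂(m.condP (a, m.X ω)), m.A ω' = a ∧ m.X ω' = m.X ω :=
  ae_of_ae_map hm.measurable_X.aemeasurable hm.concentrated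

variable [IsProbabilityMeasure P]

/-- Positivity holds for almost every treatment simultaneously, outside a null set of covariates;
and at the observed treatment. -/
lemma exists_ae_le_fA (hm : m.Assumptions P) : ∃ ε > 0,
    (∀ᵐ ω ∂P, ∀ᵐ a ∂(volume.restrict m.𝒜), ε ≤ m.fA a (m.X ω)) ∧
      ∀ᵐ ω ∂P, ε ≤ m.fA (m.A ω) (m.X ω) := by
  obtain ⟨ε, hε, hpos⟩ := hm.positivity
  have := Measure.isProbabilityMeasure_map (μ := P) hm.measurable_X.aemeasurable
  have hmeas : MeasurableSet {z : ℝ × EuclideanSpace ℝ (Fin d) | ε ≤ m.fA z.1 z.2} :=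
    measurableSet_le measurable_const hm.measurable_fA
  have h1 : ∀ᵐ a ∂(volume.restrict m.𝒜), ∀ᵐ x ∂(P.map m.X), ε ≤ m.fA a x :=
    (ae_restrict_iff' hm.measurableSet_𝒜).2 (ae_of_all _ hpos)
  have h2 := (Measure.ae_ae_comm (p := fun a x => ε ≤ m.fA a x) hmeas).1 h1
  have h3 : ∀ᵐ z ∂((P.map m.X).prod (volume.restrict m.𝒜)), ε ≤ m.fA z.2 z.1 :=
    (Measure.ae_prod_iff_ae_ae (measurable_swap hmeas)).2 h2
  refine ⟨ε, hε, ae_of_ae_map hm.measurable_X.aemeasurable h2, ?_⟩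
  have h4 := (withDensity_absolutelyContinuous ((P.map m.X).prod (volume.restrict m.𝒜))
    (fun p => ENNReal.ofReal (m.fA p.2 p.1))).ae_le h3
  rw [← hm.fA_density] at h4
  exact ae_of_ae_map (hm.measurable_X.prodMk hm.measurable_A).aemeasurable h4

lemma integral_eq_integral_fA (hm : m.Assumptions P) {q : EuclideanSpace ℝ (Fin d) × ℝ → ℝ}
    (hq : Measurable q) (hqi : Integrable (fun ω => q (m.X ω, m.A ω)) P) :
    ∫ ω, q (m.X ω, m.A ω) ∂P
      = ∫ ω, (∫ a in m.𝒜, m.fA a (m.X ω) * q (m.X ω, a)) ∂P := by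
  have := Measure.isProbabilityMeasure_map (μ := P) hm.measurable_X.aemeasurable
  have hXA := (hm.measurable_X.prodMk hm.measurable_A).aemeasurable (μ := P)
  have hf : Measurable fun p : EuclideanSpace ℝ (Fin d) × ℝ => m.fA p.2 p.1 :=
    hm.measurable_fA.comp measurable_swap
  have hqi' : Integrable q (P.map fun ω => (m.X ω, m.A ω)) :=
    (integrable_map_measure hq.aestronglyMeasurable hXA).2 hqi
  rw [hm.fA_density, integrable_withDensity_iff_integrable_smul' hf.ennreal_ofReal
    (ae_of_all _ fun _ => ENNReal.ofReal_lt_top)] at hqi'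
  rw [← integral_map hXA hq.aestronglyMeasurable, hm.fA_density,
    integral_withDensity_eq_integral_toReal_smul hf.ennreal_ofReal
      (ae_of_all _ fun _ => ENNReal.ofReal_lt_top), integral_prod _ hqi',
    integral_map hm.measurable_X.aemeasurable]
  · simp only [ENNReal.toReal_ofReal (hm.fA_nonneg _ _), smul_eq_mul]
  · exact ((hf.ennreal_ofReal.ennreal_toReal.smul hq).stronglyMeasurable.integral_prod_right
      (ν := volume.restrict m.𝒜)).aestronglyMeasurable

/-- Inverse probability weighting replaces the law of the treatment by Lebesgue measure. -/
lemma integral_weighted_eq (hm : m.Assumptions P) {k : EuclideanSpace ℝ (Fin d) × ℝ → ℝ}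
    (hk : Measurable k) {C : ℝ} (hC : ∀ z, |k z| ≤ C) {ψ : ℝ → ℝ} (hψ : Measurable ψ) {B : ℝ}
    (hB : ∀ y, |ψ y| ≤ B) :
    ∫ ω, k (m.X ω, m.A ω) / m.fA (m.A ω) (m.X ω) * ψ (m.Y ω) ∂P
      = ∫ ω, (∫ a in m.𝒜, k (m.X ω, a) * m.condMeanOutcome ψ a (m.X ω)) ∂P := by
  obtain ⟨ε, hε, hpos, hposA⟩ := hm.exists_ae_le_fA
  have := hm.markov_condP
  have hX := hm.measurable_X
  have hA := hm.measurable_A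
  have hf : Measurable fun p : EuclideanSpace ℝ (Fin d) × ℝ => m.fA p.2 p.1 :=
    hm.measurable_fA.comp measurable_swap
  have hkf : Measurable fun p : EuclideanSpace ℝ (Fin d) × ℝ => k p / m.fA p.2 p.1 := hk.div hf
  have hXA : Measurable fun ω => (m.X ω, m.A ω) := hX.prodMk hA
  have hmeas : Measurable fun ω => k (m.X ω, m.A ω) / m.fA (m.A ω) (m.X ω) * ψ (m.Y ω) :=
    (hkf.comp hXA).mul (hψ.comp hm.measurable_Y)
  have hν : Measurable fun p : EuclideanSpace ℝ (Fin d) × ℝ => m.condMeanOutcome ψ p.2 p.1 :=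
    (hm.measurable_condMeanOutcome hψ).comp measurable_swap
  have hbound (r : Ω → ℝ) (hr : ∀ ω, |r ω| ≤ B) : ∀ᵐ ω ∂P,
      ‖k (m.X ω, m.A ω) / m.fA (m.A ω) (m.X ω) * r ω‖ ≤ C / ε * B := by
    filter_upwards [hposA] with ω hω
    rw [Real.norm_eq_abs, abs_mul, abs_div, abs_of_pos (hε.trans_le hω)]
    have hC0 : 0 ≤ C := (abs_nonneg _).trans (hC (m.X ω, m.A ω))
    gcongr
    exacts [hC _, hr _]
  rw [hm.integral_eq_integral_condP hmeas
    (.of_bound hmeas.aestronglyMeasurable _ (hbound _ fun ω => hB _))]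
  have e1 : ∫ ω, ∫ ω', k (m.X ω', m.A ω') / m.fA (m.A ω') (m.X ω') * ψ (m.Y ω')
        ∂(m.condP (m.A ω, m.X ω)) ∂P
      = ∫ ω, k (m.X ω, m.A ω) / m.fA (m.A ω) (m.X ω)
        * m.condMeanOutcome ψ (m.A ω) (m.X ω) ∂P := by
    refine integral_congr_ae ?_
    filter_upwards [hm.ae_concentrated, hm.treatment_mem] with ω hω hAω
    rw [condMeanOutcome, ← integral_const_mul]
    refine integral_congr_ae ?_
    filter_upwards [hω _ hAω] with ω' hω'
    rw [hω'.1, hω'.2]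
  have hq : Measurable fun p : EuclideanSpace ℝ (Fin d) × ℝ =>
    k p / m.fA p.2 p.1 * m.condMeanOutcome ψ p.2 p.1 := hkf.mul hν
  rw [e1, hm.integral_eq_integral_fA (q := fun p => k p / m.fA p.2 p.1
    * m.condMeanOutcome ψ p.2 p.1) hq (.of_bound (hq.comp hXA).aestronglyMeasurable _
      (hbound _ fun ω => hm.abs_condMeanOutcome_le hB _ _))]
  refine integral_congr_ae ?_
  filter_upwards [hpos] with ω hω
  refine integral_congr_ae ?_
  filter_upwards [hω] with a ha
  have : m.fA a (m.X ω) ≠ 0 := (hε.trans_le ha).ne'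
  field_simp

end Assumptions

end CausalModel

/-! ### Regularity of conditional means at the policy -/

/-- A symmetric second-order expansion determines its quadratic coefficient. -/
lemma tendsto_symm_quotient {F : ℝ → ℝ} {p δ D L : ℝ} (hδ : 0 < δ)
    (hF : ∀ t, |t| < δ → |F (p + t) + F (p - t) - 2 * F p - t ^ 2 * D| ≤ L * |t| ^ 3) :
    Tendsto (fun n : ℕ => (F (p + δ / (n + 2)) + F (p - δ / (n + 2)) - 2 * F p)
      / (δ / (n + 2)) ^ 2) atTop (𝓝 D) := by
  have hlim : Tendsto (fun n : ℕ => L * (δ / ((n : ℝ) + 2))) atTop (𝓝 0) := by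
    have : Tendsto (fun n : ℕ => (n : ℝ) + 2) atTop atTop :=
      tendsto_atTop_add_const_right _ _ tendsto_natCast_atTop_atTop
    simpa using (this.const_div_atTop δ).const_mul L
  rw [tendsto_iff_dist_tendsto_zero]
  refine squeeze_zero (fun _ => dist_nonneg) (fun n => ?_) hlim
  have ht : 0 < δ / ((n : ℝ) + 2) := by positivity
  have ht' : δ / ((n : ℝ) + 2) < δ := div_lt_self hδ (by linarith [(n.cast_nonneg : (0 : ℝ) ≤ n)])
  set t := δ / ((n : ℝ) + 2)
  have := hF t (by rwa [abs_of_pos ht])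
  rw [abs_of_pos ht] at this
  rw [Real.dist_eq]
  have e : (F (p + t) + F (p - t) - 2 * F p) / t ^ 2 - D
      = (F (p + t) + F (p - t) - 2 * F p - t ^ 2 * D) / t ^ 2 := by field_simp
  rw [e, abs_div, abs_of_pos (pow_pos ht 2), div_le_iff₀ (by positivity)]
  linarith

namespace CausalModel

namespace Assumptions

variable {Ω : Type*} [MeasurableSpace Ω] {d : ℕ} {m : CausalModel Ω d} {P : Measure Ω}

lemma isFiniteMeasure_restrict_outcome (hm : m.Assumptions P) :
    IsFiniteMeasure (volume.restrict m.𝒴) := by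
  obtain ⟨M, -, hM⟩ := hm.bounded_outcome
  rw [isFiniteMeasure_restrict]
  exact ((measure_mono hM).trans_lt (by simp)).ne

lemma ae_density (hm : m.Assumptions P) : ∀ᵐ ω ∂P, ∀ a ∈ m.𝒜,
    (m.condP (a, m.X ω)).map m.Y =
      (volume.restrict m.𝒴).withDensity (fun y => ENNReal.ofReal (m.fY y a (m.X ω))) :=
  ae_of_ae_map hm.measurable_X.aemeasurable hm.fY_density

section FixedCovariate

variable {a : ℝ} {x : EuclideanSpace ℝ (Fin d)} {G : ℝ → ℝ}

lemma measurable_fY_left (hm : m.Assumptions P) (a : ℝ) (x : EuclideanSpace ℝ (Fin d)) :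
    Measurable fun y => m.fY y a x :=
  hm.measurable_fY.comp (g := fun p : ℝ × ℝ × EuclideanSpace ℝ (Fin d) => m.fY p.1 p.2.1 p.2.2)
    (f := fun y => (y, a, x)) (by fun_prop)

lemma aestronglyMeasurable_map_condP
    (hdens : (m.condP (a, x)).map m.Y =
      (volume.restrict m.𝒴).withDensity (fun y => ENNReal.ofReal (m.fY y a x)))
    (hG : AEStronglyMeasurable G (volume.restrict m.𝒴)) :
    AEStronglyMeasurable G ((m.condP (a, x)).map m.Y) := by
  rw [hdens]
  exact hG.mono_ac (withDensity_absolutelyContinuous _ _)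

/-- Conditional integrals of functions of the outcome through its density. -/
lemma integral_condP_eq (hm : m.Assumptions P)
    (hdens : (m.condP (a, x)).map m.Y =
      (volume.restrict m.𝒴).withDensity (fun y => ENNReal.ofReal (m.fY y a x)))
    (hG : AEStronglyMeasurable G (volume.restrict m.𝒴)) :
    ∫ ω, G (m.Y ω) ∂(m.condP (a, x)) = ∫ y in m.𝒴, m.fY y a x * G y := by
  rw [← integral_map hm.measurable_Y.aemeasurable (aestronglyMeasurable_map_condP hdens hG),
    hdens, integral_withDensity_eq_integral_toReal_smul
      (hm.measurable_fY_left a x).ennreal_ofReal (ae_of_all _ fun _ => ENNReal.ofReal_lt_top)]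
  simp only [ENNReal.toReal_ofReal (hm.fY_nonneg _ _ _), smul_eq_mul]

lemma integrable_condP_iff (hm : m.Assumptions P)
    (hdens : (m.condP (a, x)).map m.Y =
      (volume.restrict m.𝒴).withDensity (fun y => ENNReal.ofReal (m.fY y a x)))
    (hG : AEStronglyMeasurable G (volume.restrict m.𝒴)) :
    Integrable (fun ω => G (m.Y ω)) (m.condP (a, x)) ↔
      IntegrableOn (fun y => m.fY y a x * G y) m.𝒴 := by
  have := integrable_map_measure (aestronglyMeasurable_map_condP hdens hG)
    hm.measurable_Y.aemeasurable
  rw [← Function.comp_def, ← this, hdens, integrable_withDensity_iff_integrable_smul'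
    (hm.measurable_fY_left a x).ennreal_ofReal (ae_of_all _ fun _ => ENNReal.ofReal_lt_top)]
  simp only [ENNReal.toReal_ofReal (hm.fY_nonneg _ _ _), smul_eq_mul, IntegrableOn]

lemma ae_mem_outcome (hm : m.Assumptions P)
    (hdens : (m.condP (a, x)).map m.Y =
      (volume.restrict m.𝒴).withDensity (fun y => ENNReal.ofReal (m.fY y a x))) :
    ∀ᵐ ω ∂(m.condP (a, x)), m.Y ω ∈ m.𝒴 := by
  refine ae_of_ae_map hm.measurable_Y.aemeasurable ?_
  rw [hdens]
  exact (withDensity_absolutelyContinuous _ _).ae_le (ae_restrict_mem hm.measurableSet_𝒴)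

variable {p δ C : ℝ}

/-- On the outcome set, the second treatment derivative is a limit of difference quotients, which are
measurable in the outcome. -/
lemma aestronglyMeasurable_deriv2 (hm : m.Assumptions P)
    (hsm : ∀ y ∈ m.𝒴, ThriceDiffBounded (fun a => m.fY y a x) m.𝒜 C) (hδ : 0 < δ)
    (hball : Metric.ball p δ ⊆ m.𝒜) :
    AEStronglyMeasurable (fun y => iteratedDeriv 2 (fun a => m.fY y a x) p)
      (volume.restrict m.𝒴) := by
  refine aestronglyMeasurable_of_tendsto_ae atTop (f := fun (n : ℕ) y =>
    (m.fY y (p + δ / (n + 2)) x + m.fY y (p - δ / (n + 2)) x - 2 * m.fY y p x)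
      / (δ / (n + 2)) ^ 2) (fun n => ?_) ?_
  · have := hm.measurable_fY_left (x := x)
    exact Measurable.aestronglyMeasurable (by fun_prop)
  · refine ae_restrict_of_forall_mem hm.measurableSet_𝒴 fun y hy => ?_
    exact tendsto_symm_quotient (F := fun a => m.fY y a x) hδ
      fun t ht => (hsm y hy).abs_symm_sub_le hball ht

/-- Conditional means inherit the regularity of the outcome density. -/
lemma condMeanOutcome_regular (hm : m.Assumptions P)
    (hdens : ∀ a ∈ m.𝒜, (m.condP (a, x)).map m.Y =
      (volume.restrict m.𝒴).withDensity (fun y => ENNReal.ofReal (m.fY y a x)))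
    (hsm : ∀ y ∈ m.𝒴, ThriceDiffBounded (fun a => m.fY y a x) m.𝒜 C) (hδ : 0 < δ)
    (hball : Metric.ball p δ ⊆ m.𝒜) {ψ : ℝ → ℝ} (hψ : Measurable ψ) {B : ℝ}
    (hB : ∀ y, |ψ y| ≤ B) :
    |m.integralDeriv2 ψ p x| ≤ 2 * (B * |C|) * volume.real m.𝒴 ∧
    (∀ t, |t| < δ → |m.condMeanOutcome ψ (p + t) x + m.condMeanOutcome ψ (p - t) x
      - 2 * m.condMeanOutcome ψ p x - t ^ 2 * m.integralDeriv2 ψ p x|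
        ≤ 2 * (B * |C|) * volume.real m.𝒴 * |t| ^ 3) ∧
    ∀ t, |t| < δ → |m.condMeanOutcome ψ (p + t) x - m.condMeanOutcome ψ p x|
        ≤ 2 * (B * |C|) * volume.real m.𝒴 * |t| := by
  have := hm.isFiniteMeasure_restrict_outcome
  have hvol : (volume.restrict m.𝒴).real Set.univ = volume.real m.𝒴 := by simp
  have hmem {t : ℝ} (ht : |t| < δ) : p + t ∈ m.𝒜 := hball (by simpa [Real.dist_eq] using ht)
  have h0 : |(0 : ℝ)| < δ := by simpa using hδ
  have hB0 : 0 ≤ B := (abs_nonneg _).trans (hB 0)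
  have hfin {F : ℝ → ℝ} {b : ℝ} (hF : ∀ y ∈ m.𝒴, |F y| ≤ b) :
      |∫ y in m.𝒴, F y| ≤ b * volume.real m.𝒴 := by
    rw [← hvol, ← Real.norm_eq_abs]
    exact norm_integral_le_of_norm_le_const (ae_restrict_of_forall_mem hm.measurableSet_𝒴 hF)
  have hint {t : ℝ} (ht : |t| < δ) :
      Integrable (fun y => m.fY y (p + t) x * ψ y) (volume.restrict m.𝒴) := by
    refine .of_bound ((hm.measurable_fY_left _ x).mul hψ).aestronglyMeasurable (|C| * B) ?_
    refine ae_restrict_of_forall_mem hm.measurableSet_𝒴 fun y hy => ?_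
    rw [Real.norm_eq_abs, abs_mul]
    have h1 := (hsm y hy).abs_iteratedDeriv_le hball ht (k := 0) (by norm_num)
    rw [iteratedDeriv_zero] at h1
    exact mul_le_mul (h1.trans (le_abs_self C)) (hB y) (abs_nonneg _) (abs_nonneg _)
  have hν {t : ℝ} (ht : |t| < δ) :
      m.condMeanOutcome ψ (p + t) x = ∫ y in m.𝒴, m.fY y (p + t) x * ψ y :=
    hm.integral_condP_eq (hdens _ (hmem ht)) hψ.aestronglyMeasurable
  have hν0 := hν h0
  have hint0 := hint h0
  rw [add_zero] at hν0 hint0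
  have hd2 : Integrable (fun y => ψ y * iteratedDeriv 2 (fun a => m.fY y a x) p)
      (volume.restrict m.𝒴) := by
    refine .of_bound (hψ.aestronglyMeasurable.mul (hm.aestronglyMeasurable_deriv2 hsm hδ hball))
      (B * |C|) ?_
    refine ae_restrict_of_forall_mem hm.measurableSet_𝒴 fun y hy => ?_
    rw [Real.norm_eq_abs, abs_mul]
    have h1 := (hsm y hy).abs_iteratedDeriv_le hball h0 (k := 2) (by norm_num)
    rw [add_zero] at h1
    exact mul_le_mul (hB y) (h1.trans (le_abs_self C)) (abs_nonneg _) hB0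
  refine ⟨hfin fun y hy => ?_, fun t ht => ?_, fun t ht => ?_⟩
  · have h1 := (hsm y hy).abs_iteratedDeriv_le hball h0 (k := 2) (by norm_num)
    rw [add_zero] at h1
    rw [abs_mul]
    have : |ψ y| * |iteratedDeriv 2 (fun a => m.fY y a x) p| ≤ B * |C| :=
      mul_le_mul (hB y) (h1.trans (le_abs_self C)) (abs_nonneg _) hB0
    have : 0 ≤ B * |C| := by positivity
    linarith
  · have ht' : |-t| < δ := by simpa using ht
    have hνm := hν ht'
    have hintm := hint ht'
    rw [← sub_eq_add_neg] at hνm hintm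
    have i1 := (hint ht).add hintm
    have i2 := i1.sub (hint0.const_mul 2)
    rw [hν ht, hνm, hν0, integralDeriv2, ← integral_const_mul, ← integral_const_mul,
      ← integral_add (hint ht) hintm, ← integral_sub (by exact i1) (hint0.const_mul 2),
      ← integral_sub (by exact i2) (hd2.const_mul _)]
    rw [mul_right_comm]
    refine hfin fun y hy => ?_
    have h1 := (hsm y hy).abs_symm_sub_le hball ht
    have e : m.fY y (p + t) x * ψ y + m.fY y (p - t) x * ψ y - 2 * (m.fY y p x * ψ y)
        - t ^ 2 * (ψ y * iteratedDeriv 2 (fun a => m.fY y a x) p)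
        = ψ y * (m.fY y (p + t) x + m.fY y (p - t) x - 2 * m.fY y p x
          - t ^ 2 * iteratedDeriv 2 (fun a => m.fY y a x) p) := by ring
    rw [e, abs_mul]
    calc _ ≤ B * (2 * C * |t| ^ 3) := mul_le_mul (hB y) h1 (abs_nonneg _) hB0
      _ ≤ B * (2 * |C| * |t| ^ 3) := by gcongr; exact le_abs_self C
      _ = _ := by ring
  · rw [hν ht, hν0, ← integral_sub (hint ht) hint0, mul_right_comm]
    refine hfin fun y hy => ?_
    have h1 := (hsm y hy).abs_iteratedDeriv_sub_le hball ht (k := 0) (by norm_num)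
    rw [iteratedDeriv_zero] at h1
    rw [← sub_mul, abs_mul, mul_comm]
    calc _ ≤ B * (C * |t|) := mul_le_mul (hB y) h1 (abs_nonneg _) hB0
      _ ≤ B * (|C| * |t|) := by gcongr; exact le_abs_self C
      _ ≤ 2 * (B * |C|) * |t| := by
        have : 0 ≤ B * |C| * |t| := by positivity
        linarith

end FixedCovariate

variable {π : EuclideanSpace ℝ (Fin d) → ℝ} {ψ : ℝ → ℝ} {B : ℝ}

/-- Almost surely, with uniform constants: the policy is in the interior of the treatment set, and the
conditional mean of `ψ(Y)` is Lipschitz and has a symmetric second-order expansion there. -/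
lemma exists_ae_regular (hm : m.Assumptions P)
    (hπ𝒜 : ∃ δ > 0, ∀ᵐ ω ∂P, Metric.ball (π (m.X ω)) δ ⊆ m.𝒜) (hψ : Measurable ψ)
    (hB : ∀ y, |ψ y| ≤ B) : ∃ δ L, 0 < δ ∧ δ ≤ 1 ∧ ∀ᵐ ω ∂P,
      Metric.ball (π (m.X ω)) δ ⊆ m.𝒜 ∧ |m.integralDeriv2 ψ (π (m.X ω)) (m.X ω)| ≤ L ∧
      (∀ t, |t| < δ → |m.condMeanOutcome ψ (π (m.X ω) + t) (m.X ω)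
        + m.condMeanOutcome ψ (π (m.X ω) - t) (m.X ω)
        - 2 * m.condMeanOutcome ψ (π (m.X ω)) (m.X ω)
        - t ^ 2 * m.integralDeriv2 ψ (π (m.X ω)) (m.X ω)| ≤ L * |t| ^ 3) ∧
      ∀ t, |t| < δ → |m.condMeanOutcome ψ (π (m.X ω) + t) (m.X ω)
        - m.condMeanOutcome ψ (π (m.X ω)) (m.X ω)| ≤ L * |t| := by
  obtain ⟨δ, hδ, hball⟩ := hπ𝒜
  obtain ⟨C, hC⟩ := hm.smooth_fY
  refine ⟨min δ 1, 2 * (B * |C|) * volume.real m.𝒴, lt_min hδ one_pos, min_le_right _ _, ?_⟩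
  filter_upwards [hball, ae_of_ae_map hm.measurable_X.aemeasurable hC, hm.ae_density]
    with ω h1 h2 h3
  have h1' := (Metric.ball_subset_ball (min_le_left δ 1)).trans h1
  exact ⟨h1', hm.condMeanOutcome_regular h3 h2 (lt_min hδ one_pos) h1' hψ hB⟩

lemma measurable_condMeanOutcome_policy (hm : m.Assumptions P) (hπ : Measurable π)
    (hψ : Measurable ψ) (c : ℝ) :
    Measurable fun ω => m.condMeanOutcome ψ (π (m.X ω) + c) (m.X ω) :=
  (hm.measurable_condMeanOutcome hψ).comp
    (((hπ.comp hm.measurable_X).add_const c).prodMk hm.measurable_X)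

/-- The second derivative of the outcome density integrates to zero, as the total mass of the density
is constant in the treatment. -/
lemma ae_integralDeriv2_one (hm : m.Assumptions P)
    (hπ𝒜 : ∃ δ > 0, ∀ᵐ ω ∂P, Metric.ball (π (m.X ω)) δ ⊆ m.𝒜) :
    ∀ᵐ ω ∂P, m.integralDeriv2 (fun _ => 1) (π (m.X ω)) (m.X ω) = 0 := by
  have := hm.markov_condP
  obtain ⟨δ, L, hδ, -, hreg⟩ := hm.exists_ae_regular hπ𝒜 (ψ := fun _ => 1) measurable_const
    (B := 1) (by simp)
  filter_upwards [hreg] with ω h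
  refine tendsto_nhds_unique (tendsto_symm_quotient
    (F := fun a => m.condMeanOutcome (fun _ => 1) a (m.X ω)) hδ h.2.2.1) ?_
  simp [condMeanOutcome]
  norm_num

variable [IsProbabilityMeasure P]

lemma integrable_condMeanOutcome (hm : m.Assumptions P) (hπ : Measurable π)
    (hψ : Measurable ψ) (hB : ∀ y, |ψ y| ≤ B) :
    Integrable (fun ω => m.condMeanOutcome ψ (π (m.X ω)) (m.X ω)) P := by
  refine .of_bound ?_ B (ae_of_all _ fun ω => hm.abs_condMeanOutcome_le hB _ _)
  simpa using (hm.measurable_condMeanOutcome_policy hπ hψ 0).aestronglyMeasurable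

/-- Measurability in the covariates holds because the second derivative is almost surely a limit of
difference quotients of conditional means. -/
lemma integrable_integralDeriv2 (hm : m.Assumptions P) (hπ : Measurable π)
    (hπ𝒜 : ∃ δ > 0, ∀ᵐ ω ∂P, Metric.ball (π (m.X ω)) δ ⊆ m.𝒜) (hψ : Measurable ψ)
    (hB : ∀ y, |ψ y| ≤ B) :
    Integrable (fun ω => m.integralDeriv2 ψ (π (m.X ω)) (m.X ω)) P := by
  obtain ⟨δ, L, hδ, -, hreg⟩ := hm.exists_ae_regular hπ𝒜 hψ hB
  refine .of_bound ?_ L (hreg.mono fun ω h => h.2.1)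
  refine aestronglyMeasurable_of_tendsto_ae atTop (f := fun (n : ℕ) ω =>
    (m.condMeanOutcome ψ (π (m.X ω) + δ / (n + 2)) (m.X ω)
      + m.condMeanOutcome ψ (π (m.X ω) - δ / (n + 2)) (m.X ω)
      - 2 * m.condMeanOutcome ψ (π (m.X ω)) (m.X ω)) / (δ / (n + 2)) ^ 2) (fun n => ?_) ?_
  · have h1 := hm.measurable_condMeanOutcome_policy hπ hψ (δ / (n + 2))
    have h2 := hm.measurable_condMeanOutcome_policy hπ hψ (-(δ / (n + 2)))
    have h3 := hm.measurable_condMeanOutcome_policy hπ hψ 0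
    simp only [add_zero, ← sub_eq_add_neg] at h2 h3
    exact (((h1.add h2).sub (h3.const_mul 2)).div_const _).aestronglyMeasurable
  · filter_upwards [hreg] with ω h
    exact tendsto_symm_quotient (F := fun a => m.condMeanOutcome ψ a (m.X ω)) hδ h.2.2.1

/-- The density of the treatment is continuous and bounded below at the policy. Positivity at a fixed
treatment excludes a null set of covariates that depends on the treatment; smoothness carries the
almost-everywhere bound over to the treatment `π(X)`. -/
lemma exists_ae_fA_policy (hm : m.Assumptions P)
    (hπ𝒜 : ∃ δ > 0, ∀ᵐ ω ∂P, Metric.ball (π (m.X ω)) δ ⊆ m.𝒜) : ∃ ε > 0,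
    (∀ᵐ ω ∂P, ∀ᵐ a ∂(volume.restrict m.𝒜), ε ≤ m.fA a (m.X ω)) ∧
    (∀ᵐ ω ∂P, ε ≤ m.fA (m.A ω) (m.X ω)) ∧
    ∀ᵐ ω ∂P, ε ≤ m.fA (π (m.X ω)) (m.X ω) ∧
      ContinuousAt (fun a => m.fA a (m.X ω)) (π (m.X ω)) := by
  obtain ⟨ε, hε, h1, h2⟩ := hm.exists_ae_le_fA
  obtain ⟨δ, hδ, hball⟩ := hπ𝒜
  obtain ⟨C, hC⟩ := hm.smooth_fA
  refine ⟨ε, hε, h1, h2, ?_⟩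
  filter_upwards [h1, hball, ae_of_ae_map hm.measurable_X.aemeasurable hC] with ω hω hb hs
  have hc : ContinuousAt (fun a => m.fA a (m.X ω)) (π (m.X ω)) := by
    have := hs.hasDerivAt (interior_maximal hb Metric.isOpen_ball (Metric.mem_ball_self hδ))
      (k := 0) (by norm_num)
    rw [iteratedDeriv_zero] at this
    exact this.continuousAt
  refine ⟨?_, hc⟩
  by_contra! hlt
  have hev := (hc.eventually_lt continuousAt_const hlt).and (Metric.ball_mem_nhds _ hδ)
  obtain ⟨U, hU, hUo, hmem⟩ := eventually_nhds_iff.1 hev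
  have hpos := hUo.measure_pos volume ⟨_, hmem⟩
  have hω' : ∀ᵐ a ∂(volume : Measure ℝ), a ∈ m.𝒜 → ε ≤ m.fA a (m.X ω) :=
    (ae_restrict_iff' hm.measurableSet_𝒜).1 hω
  have hnull : volume U = 0 := by
    refine measure_mono_null (fun a ha => ?_) (ae_iff.1 hω')
    simp only [Set.mem_ofPred_eq]
    exact fun hcon => (hU a ha).1.not_ge (hcon (hb (hU a ha).2))
  exact hpos.ne' hnull

end Assumptions

end CausalModel

/-! ### Moments of the weighted outcomes -/

namespace CausalModel

namespace Assumptions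

variable {Ω : Type*} [MeasurableSpace Ω] {d : ℕ} {m : CausalModel Ω d} {P : Measure Ω}
  {π : EuclideanSpace ℝ (Fin d) → ℝ} {K ψ : ℝ → ℝ} {B : ℝ}

lemma measurable_weight (hm : m.Assumptions P) (hK : IsSecondOrderKernel K) (hπ : Measurable π)
    (h : ℝ) : Measurable fun p : EuclideanSpace ℝ (Fin d) × ℝ => m.weight K π h p.1 p.2 := by
  have := hK.measurable
  have hf : Measurable fun p : EuclideanSpace ℝ (Fin d) × ℝ => m.fA p.2 p.1 :=
    hm.measurable_fA.comp measurable_swap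
  unfold weight scaledKernel
  fun_prop

variable [IsProbabilityMeasure P]

/-- The weights are of order `1 / h`. -/
lemma exists_ae_abs_weight_le (hm : m.Assumptions P) (hK : IsSecondOrderKernel K) :
    ∃ c ≥ 0, ∀ h > 0, ∀ᵐ ω ∂P, |m.weight K π h (m.X ω) (m.A ω)| ≤ c / h := by
  obtain ⟨ε, hε, -, hposA⟩ := hm.exists_ae_le_fA
  obtain ⟨M, hM⟩ := hK.bounded
  have hM0 : 0 ≤ M := (abs_nonneg _).trans (hM 0)
  refine ⟨M / ε, by positivity, fun h hh => ?_⟩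
  filter_upwards [hposA] with ω hω
  rw [weight, scaledKernel, abs_div, abs_mul, abs_of_pos (hε.trans_le hω),
    abs_of_pos (one_div_pos.2 hh)]
  calc _ ≤ 1 / h * M / ε := by gcongr; exact hM _
    _ = M / ε / h := by ring

/-- The bias expansion of the weighted mean of `ψ(Y)`. -/
lemma exists_abs_integral_weight_sub_le (hm : m.Assumptions P) (hK : IsSecondOrderKernel K)
    (hπ : Measurable π) (hπ𝒜 : ∃ δ > 0, ∀ᵐ ω ∂P, Metric.ball (π (m.X ω)) δ ⊆ m.𝒜)
    (hψ : Measurable ψ) (hB : ∀ y, |ψ y| ≤ B) : ∃ c, ∀ h > 0,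
      |(∫ ω, m.weight K π h (m.X ω) (m.A ω) * ψ (m.Y ω) ∂P)
        - ((∫ ω, m.condMeanOutcome ψ (π (m.X ω)) (m.X ω) ∂P)
          + h ^ 2 * ((∫ u, u ^ 2 * K u) / 2
            * ∫ ω, m.integralDeriv2 ψ (π (m.X ω)) (m.X ω) ∂P))|
        ≤ h ^ 2 * (c * smoothingRemainder K h) := by
  obtain ⟨δ, L, hδ, hδ1, hreg⟩ := hm.exists_ae_regular hπ𝒜 hψ hB
  obtain ⟨M, hM⟩ := hK.bounded
  have hKm := hK.measurable
  have hB0 : 0 ≤ B := (abs_nonneg _).trans (hB 0)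
  refine ⟨L + (2 * B / δ ^ 2 + L) / δ, fun h hh => ?_⟩
  set κ := (∫ u, u ^ 2 * K u) / 2
  set R := h ^ 2 * ((L + (2 * B / δ ^ 2 + L) / δ) * smoothingRemainder K h)
  have hk : Measurable fun z : EuclideanSpace ℝ (Fin d) × ℝ => scaledKernel K h (π z.1 - z.2) := by
    unfold scaledKernel
    fun_prop
  have hkb (z : EuclideanSpace ℝ (Fin d) × ℝ) : |scaledKernel K h (π z.1 - z.2)| ≤ 1 / h * M := by
    rw [scaledKernel, abs_mul, abs_of_pos (one_div_pos.2 hh)]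
    gcongr
    exact hM _
  have hν := hm.measurable_condMeanOutcome hψ
  have hν' : Measurable fun p : EuclideanSpace ℝ (Fin d) × ℝ => m.condMeanOutcome ψ p.2 p.1 :=
    hν.comp measurable_swap
  have heq := hm.integral_weighted_eq hk hkb hψ hB
  simp only [weight]
  rw [heq]
  set I : Ω → ℝ := fun ω => ∫ a in m.𝒜, scaledKernel K h (π (m.X ω) - a)
    * m.condMeanOutcome ψ a (m.X ω) with hI
  have hIm : AEStronglyMeasurable I P := by
    have : StronglyMeasurable fun x => ∫ a in m.𝒜, scaledKernel K h (π x - a)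
        * m.condMeanOutcome ψ a x :=
      (hk.mul hν').stronglyMeasurable.integral_prod_right (ν := volume.restrict m.𝒜)
    exact (this.measurable.comp hm.measurable_X).aestronglyMeasurable
  set T : Ω → ℝ := fun ω => m.condMeanOutcome ψ (π (m.X ω)) (m.X ω)
    + h ^ 2 * (κ * m.integralDeriv2 ψ (π (m.X ω)) (m.X ω)) with hT
  have hν0 := hm.integrable_condMeanOutcome hπ hψ hB
  have hD := ((hm.integrable_integralDeriv2 hπ hπ𝒜 hψ hB).const_mul κ).const_mul (h ^ 2)
  have hTi : Integrable T P := hν0.add hD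
  have hclose : ∀ᵐ ω ∂P, ‖I ω - T ω‖ ≤ R := by
    filter_upwards [hreg] with ω hω
    obtain ⟨hball, hDL, hsymm, -⟩ := hω
    set v := m.𝒜.indicator fun a => m.condMeanOutcome ψ a (m.X ω) with hv
    have hmem {t : ℝ} (ht : |t| < δ) : π (m.X ω) + t ∈ m.𝒜 :=
      hball (by simpa [Real.dist_eq] using ht)
    have hvt {t : ℝ} (ht : |t| < δ) :
        v (π (m.X ω) + t) = m.condMeanOutcome ψ (π (m.X ω) + t) (m.X ω) :=
      Set.indicator_of_mem (hmem ht) _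
    have hv0 := hvt (t := 0) (by simpa using hδ)
    rw [add_zero] at hv0
    have hIv : I ω = ∫ a, scaledKernel K h (π (m.X ω) - a) * v a := by
      simp only [hI]
      rw [← integral_indicator hm.measurableSet_𝒜]
      exact integral_congr_ae (ae_of_all _ fun a => by
        by_cases ha : a ∈ m.𝒜 <;> simp [hv, ha])
    have := hK.abs_smooth_sub_le (v := v) (p := π (m.X ω)) (B := B) (L := L) (δ := δ)
      (D := m.integralDeriv2 ψ (π (m.X ω)) (m.X ω))
      ((hν.comp (measurable_id.prodMk measurable_const)).indicator hm.measurableSet_𝒜)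
      (fun a => by
        by_cases ha : a ∈ m.𝒜
        · simpa [hv, ha] using hm.abs_condMeanOutcome_le hB _ _
        · simpa [hv, ha] using hB0) hδ hδ1 hDL
      (fun t ht => by
        have h2 := hvt (t := -t) (by simpa using ht)
        rw [← sub_eq_add_neg] at h2
        rw [hvt ht, h2, hv0]
        exact hsymm t ht) hh
    rw [Real.norm_eq_abs, hIv, hT]
    rw [hv0] at this
    exact this
  have hIi : Integrable I P := by
    have : Integrable (fun ω => I ω - T ω) P :=
      .of_bound (hIm.sub hTi.aestronglyMeasurable) R hclose
    exact (this.add hTi).congr (ae_of_all _ fun ω => by simp)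
  have hTint : ∫ ω, T ω ∂P = (∫ ω, m.condMeanOutcome ψ (π (m.X ω)) (m.X ω) ∂P)
      + h ^ 2 * (κ * ∫ ω, m.integralDeriv2 ψ (π (m.X ω)) (m.X ω) ∂P) := by
    rw [hT, integral_add hν0 hD, integral_const_mul, integral_const_mul]
  rw [← hTint, ← integral_sub hIi hTi, ← Real.norm_eq_abs]
  refine (norm_integral_le_of_norm_le_const hclose).trans ?_
  simp

/-- The second moment of the weights grows like `1 / h`. -/
lemma tendsto_mul_integral_weight_sq (hm : m.Assumptions P) (hK : IsSecondOrderKernel K)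
    (hπ : Measurable π) (hπ𝒜 : ∃ δ > 0, ∀ᵐ ω ∂P, Metric.ball (π (m.X ω)) δ ⊆ m.𝒜)
    (hψ : Measurable ψ) (hB : ∀ y, |ψ y| ≤ B) {h : ℕ → ℝ} (h_pos : ∀ N, 0 < h N)
    (h_zero : Tendsto h atTop (𝓝 0)) :
    Tendsto (fun N => h N *
        ∫ ω, m.weight K π (h N) (m.X ω) (m.A ω) ^ 2 * ψ (m.Y ω) ∂P) atTop
      (𝓝 ((∫ u, K u ^ 2) *
        ∫ ω, m.condMeanOutcome ψ (π (m.X ω)) (m.X ω) / m.fA (π (m.X ω)) (m.X ω) ∂P)) := by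
  obtain ⟨δ, L, hδ, hδ1, hreg⟩ := hm.exists_ae_regular hπ𝒜 hψ hB
  obtain ⟨ε, hε, -, hposA, hpol⟩ := hm.exists_ae_fA_policy hπ𝒜
  obtain ⟨M, hM⟩ := hK.bounded
  have hKm := hK.measurable
  have hB0 : 0 ≤ B := (abs_nonneg _).trans (hB 0)
  have hf : Measurable fun p : EuclideanSpace ℝ (Fin d) × ℝ => m.fA p.2 p.1 :=
    hm.measurable_fA.comp measurable_swap
  have hν := hm.measurable_condMeanOutcome hψ
  have hν' : Measurable fun p : EuclideanSpace ℝ (Fin d) × ℝ => m.condMeanOutcome ψ p.2 p.1 :=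
    hν.comp measurable_swap
  -- The truncation of the density from below is invisible almost surely.
  set q : EuclideanSpace ℝ (Fin d) → ℝ → ℝ := fun x =>
    m.𝒜.indicator fun a => m.condMeanOutcome ψ a x / max (m.fA a x) ε with hq
  have hqm : Measurable fun p : EuclideanSpace ℝ (Fin d) × ℝ => q p.1 p.2 := by
    have h1 : Measurable fun p : EuclideanSpace ℝ (Fin d) × ℝ =>
      m.condMeanOutcome ψ p.2 p.1 / max (m.fA p.2 p.1) ε := hν'.div (hf.max measurable_const)
    exact h1.indicator (measurable_snd hm.measurableSet_𝒜)
  have hqx x : Measurable (q x) := hqm.comp (measurable_const.prodMk measurable_id)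
  have hqb x a : |q x a| ≤ B / ε := by
    by_cases ha : a ∈ m.𝒜
    · simp only [hq, Set.indicator_of_mem ha]
      rw [abs_div, abs_of_pos (hε.trans_le (le_max_right _ _))]
      gcongr
      · exact hm.abs_condMeanOutcome_le hB _ _
      · exact le_max_right _ _
    · simp only [hq, Set.indicator_of_notMem ha, abs_zero]
      positivity
  have hqc : ∀ᵐ ω ∂P, ContinuousAt (q (m.X ω)) (π (m.X ω)) ∧ q (m.X ω) (π (m.X ω))
      = m.condMeanOutcome ψ (π (m.X ω)) (m.X ω) / m.fA (π (m.X ω)) (m.X ω) := by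
    filter_upwards [hreg, hpol] with ω h1 h2
    obtain ⟨hball, -, -, hlip⟩ := h1
    have hmem : m.𝒜 ∈ 𝓝 (π (m.X ω)) := mem_of_superset (Metric.ball_mem_nhds _ hδ) hball
    have hνc : ContinuousAt (fun a => m.condMeanOutcome ψ a (m.X ω)) (π (m.X ω)) := by
      rw [ContinuousAt, tendsto_iff_dist_tendsto_zero]
      have hl : Tendsto (fun a => L * |a - π (m.X ω)|) (𝓝 (π (m.X ω))) (𝓝 0) := by
        have : ContinuousAt (fun a => L * |a - π (m.X ω)|) (π (m.X ω)) := by fun_prop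
        simpa [ContinuousAt] using this
      refine squeeze_zero' (Eventually.of_forall fun _ => dist_nonneg) ?_ hl
      filter_upwards [Metric.ball_mem_nhds _ hδ] with a ha
      simpa [Real.dist_eq] using hlip (a - π (m.X ω)) (by simpa [Real.dist_eq] using ha)
    constructor
    · have : ContinuousAt (fun a => m.condMeanOutcome ψ a (m.X ω) / max (m.fA a (m.X ω)) ε)
          (π (m.X ω)) :=
        hνc.div (h2.2.max continuousAt_const) (hε.trans_le (le_max_right _ _)).ne'
      refine this.congr ?_
      filter_upwards [hmem] with a ha
      simp [hq, ha]
    · simp [hq, mem_of_mem_nhds hmem, max_eq_left h2.1]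
  have hmain N : h N * ∫ ω, m.weight K π (h N) (m.X ω) (m.A ω) ^ 2 * ψ (m.Y ω) ∂P
      = ∫ ω, (∫ a, 1 / h N * K ((π (m.X ω) - a) / h N) ^ 2 * q (m.X ω) a) ∂P := by
    have hN := h_pos N
    set k : EuclideanSpace ℝ (Fin d) × ℝ → ℝ := fun z =>
      1 / h N * K ((π z.1 - z.2) / h N) ^ 2 / max (m.fA z.2 z.1) ε with hk
    have hkm : Measurable k := by fun_prop
    have hkb z : |k z| ≤ 1 / h N * M ^ 2 / ε := by
      rw [hk, abs_div, abs_of_pos (hε.trans_le (le_max_right _ _)), abs_mul, abs_pow,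
        abs_of_pos (one_div_pos.2 hN)]
      gcongr
      · exact hM _
      · exact le_max_right _ _
    have e := hm.integral_weighted_eq hkm hkb hψ hB
    calc _ = ∫ ω, k (m.X ω, m.A ω) / m.fA (m.A ω) (m.X ω) * ψ (m.Y ω) ∂P := by
          rw [← integral_const_mul]
          refine integral_congr_ae ?_
          filter_upwards [hposA] with ω hω
          have hne : m.fA (m.A ω) (m.X ω) ≠ 0 := (hε.trans_le hω).ne'
          simp only [hk, max_eq_left hω, weight, scaledKernel]
          field_simp
      _ = _ := e
      _ = _ := by
          refine integral_congr_ae (ae_of_all _ fun ω => ?_)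
          simp only
          rw [← integral_indicator hm.measurableSet_𝒜]
          refine integral_congr_ae (ae_of_all _ fun a => ?_)
          by_cases ha : a ∈ m.𝒜
          · simp only [hq, hk, Set.indicator_of_mem ha]
            ring
          · simp [hq, ha]
  simp only [hmain]
  rw [← integral_const_mul]
  refine tendsto_integral_of_dominated_convergence (fun _ => (∫ u, K u ^ 2) * (B / ε))
    (fun N => ?_) (integrable_const _) (fun N => ae_of_all _ fun ω => ?_) ?_
  · have hin : Measurable fun z : EuclideanSpace ℝ (Fin d) × ℝ =>
        1 / h N * K ((π z.1 - z.2) / h N) ^ 2 * q z.1 z.2 := by fun_prop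
    have : StronglyMeasurable fun x => ∫ a, 1 / h N * K ((π x - a) / h N) ^ 2 * q x a :=
      hin.stronglyMeasurable.integral_prod_right (ν := volume)
    exact (this.measurable.comp hm.measurable_X).aestronglyMeasurable
  · exact hK.abs_smooth_sq_le (hqb _) (h_pos N)
  · filter_upwards [hqc] with ω hω
    have := hK.tendsto_smooth_sq (hqx (m.X ω)) (hqb _) hω.1 h_pos h_zero
    rwa [hω.2] at this

end Assumptions

end CausalModel

/-! ### Identification of the target, the bias and the variance -/

/-- `exp(-c y / α)`, truncated to be bounded on the whole line; nothing changes for `y ≥ 0`. -/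
noncomputable def expLoss (α c y : ℝ) : ℝ := Real.exp (-(c * max y 0) / α)

lemma measurable_expLoss (α c : ℝ) : Measurable (expLoss α c) := by
  unfold expLoss
  fun_prop

lemma expLoss_of_nonneg (α c : ℝ) {y : ℝ} (hy : 0 ≤ y) :
    expLoss α c y = Real.exp (-(c * y) / α) := by
  rw [expLoss, max_eq_left hy]

lemma expLoss_one_of_nonneg (α : ℝ) {y : ℝ} (hy : 0 ≤ y) :
    expLoss α 1 y = Real.exp (-y / α) := by
  rw [expLoss_of_nonneg α 1 hy, one_mul]

lemma expLoss_two (α y : ℝ) : expLoss α 2 y = expLoss α 1 y ^ 2 := by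
  rw [expLoss, expLoss, ← Real.exp_nat_mul]
  congr 1
  push_cast
  ring

lemma abs_expLoss_le {α c : ℝ} (hα : 0 < α) (hc : 0 ≤ c) (y : ℝ) : |expLoss α c y| ≤ 1 := by
  rw [expLoss, Real.abs_exp, Real.exp_le_one_iff]
  exact div_nonpos_of_nonpos_of_nonneg
    (neg_nonpos.2 (mul_nonneg hc (le_max_right _ _))) hα.le

namespace CausalModel

namespace Assumptions

variable {Ω : Type*} [MeasurableSpace Ω] {d : ℕ} {m : CausalModel Ω d} {P : Measure Ω}
  {π : EuclideanSpace ℝ (Fin d) → ℝ} {K : ℝ → ℝ} {α : ℝ}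

lemma nonneg_of_mem_outcome (hm : m.Assumptions P) {y : ℝ} (hy : y ∈ m.𝒴) : 0 ≤ y := by
  obtain ⟨M, -, hM⟩ := hm.bounded_outcome
  exact (hM hy).1

lemma ae_of_ae_ae_condP (hm : m.Assumptions P) {s : Set Ω} (hs : MeasurableSet s)
    (h : ∀ᵐ ω ∂P, ∀ᵐ ω' ∂(m.condP (m.A ω, m.X ω)), ω' ∈ s) : ∀ᵐ ω ∂P, ω ∈ s := by
  have hAX : Measurable fun ω => (m.A ω, m.X ω) := hm.measurable_A.prodMk hm.measurable_X
  have hP : P sᶜ = ∫⁻ ω, m.condP (m.A ω, m.X ω) sᶜ ∂P := by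
    conv_lhs => rw [← hm.disintegration]
    rw [Measure.bind_apply hs.compl m.condP.measurable.aemeasurable,
      lintegral_map (m.condP.measurable_coe hs.compl) hAX]
  rw [ae_iff]
  change P sᶜ = 0
  have hmeas : Measurable fun ω => m.condP (m.A ω, m.X ω) sᶜ :=
    (m.condP.measurable_coe hs.compl).comp hAX
  rw [hP, lintegral_eq_zero_iff hmeas]
  filter_upwards [h] with ω hω
  exact ae_iff.1 hω

lemma measurable_potential_policy (hm : m.Assumptions P) (hπ : Measurable π) :
    Measurable fun ω => m.Ypot (π (m.X ω)) ω :=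
  hm.measurable_Ypot.comp ((hπ.comp hm.measurable_X).prodMk measurable_id)

/-- Identification: by unconfoundedness and consistency, the potential outcome under the policy has,
given the covariates and the observed treatment, the conditional law of the outcome at the
treatment of the policy. -/
lemma ae_map_potential_policy (hm : m.Assumptions P)
    (hmem : ∀ᵐ ω ∂P, π (m.X ω) ∈ m.𝒜) : ∀ᵐ ω ∂P,
    (m.condP (m.A ω, m.X ω)).map (fun ω' => m.Ypot (π (m.X ω')) ω')
      = (m.condP (π (m.X ω), m.X ω)).map m.Y := by
  filter_upwards [hm.ae_concentrated, hm.treatment_mem, hmem,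
    ae_of_ae_map hm.measurable_X.aemeasurable hm.unconfoundedness] with ω hc hA hp hu
  calc _ = (m.condP (m.A ω, m.X ω)).map (m.Ypot (π (m.X ω))) := by
        refine Measure.map_congr ?_
        filter_upwards [hc _ hA] with ω' hω'
        rw [hω'.2]
    _ = (m.condP (π (m.X ω), m.X ω)).map (m.Ypot (π (m.X ω))) := hu _ hp _ hA _ hp
    _ = _ := by
        refine Measure.map_congr ?_
        filter_upwards [hc _ hp] with ω' hω'
        exact (hm.consistency ω' _ hp hω'.1).symm

lemma ae_policy_mem (hπ𝒜 : ∃ δ > 0, ∀ᵐ ω ∂P, Metric.ball (π (m.X ω)) δ ⊆ m.𝒜) :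
    ∀ᵐ ω ∂P, π (m.X ω) ∈ m.𝒜 := by
  obtain ⟨δ, hδ, hball⟩ := hπ𝒜
  filter_upwards [hball] with ω h using h (Metric.mem_ball_self hδ)

lemma ae_potential_policy_mem (hm : m.Assumptions P) (hπ : Measurable π)
    (hmem : ∀ᵐ ω ∂P, π (m.X ω) ∈ m.𝒜) : ∀ᵐ ω ∂P, m.Ypot (π (m.X ω)) ω ∈ m.𝒴 := by
  have hY := hm.measurable_potential_policy hπ
  refine hm.ae_of_ae_ae_condP (hY hm.measurableSet_𝒴) ?_
  filter_upwards [hm.ae_map_potential_policy hmem, hmem, hm.ae_density] with ω h1 h2 h3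
  refine ae_of_ae_map (p := fun y => y ∈ m.𝒴) hY.aemeasurable ?_
  rw [h1, ae_map_iff (p := fun y => y ∈ m.𝒴) hm.measurable_Y.aemeasurable hm.measurableSet_𝒴]
  exact hm.ae_mem_outcome (h3 _ h2)

section IsProbabilityMeasure

variable [IsProbabilityMeasure P]

lemma integrable_exp_potential (hm : m.Assumptions P) (hπ : Measurable π)
    (hmem : ∀ᵐ ω ∂P, π (m.X ω) ∈ m.𝒜) (hα : 0 < α) :
    Integrable (fun ω => Real.exp (-m.Ypot (π (m.X ω)) ω / α)) P := by
  have hY := hm.measurable_potential_policy hπ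
  have hexp : Measurable fun y : ℝ => Real.exp (-y / α) := by fun_prop
  refine .of_bound (hexp.comp hY).aestronglyMeasurable 1 ?_
  filter_upwards [hm.ae_potential_policy_mem hπ hmem] with ω h
  have h0 := hm.nonneg_of_mem_outcome h
  rw [← expLoss_one_of_nonneg α h0]
  exact abs_expLoss_le hα zero_le_one _

lemma target_eq (hm : m.Assumptions P) (hπ : Measurable π)
    (hmem : ∀ᵐ ω ∂P, π (m.X ω) ∈ m.𝒜) (hα : 0 < α) :
    m.target P π α = ∫ ω, m.condMeanOutcome (expLoss α 1) (π (m.X ω)) (m.X ω) ∂P := by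
  have hY := hm.measurable_potential_policy hπ
  have hg := measurable_expLoss α 1
  have e1 : m.target P π α = ∫ ω, expLoss α 1 (m.Ypot (π (m.X ω)) ω) ∂P := by
    refine integral_congr_ae ?_
    filter_upwards [hm.ae_potential_policy_mem hπ hmem] with ω h
    rw [expLoss_one_of_nonneg α (hm.nonneg_of_mem_outcome h)]
  rw [e1, hm.integral_eq_integral_condP (f := fun ω => expLoss α 1 (m.Ypot (π (m.X ω)) ω))
    (hg.comp hY) (.of_bound (hg.comp hY).aestronglyMeasurable 1
      (ae_of_all _ fun ω => abs_expLoss_le hα zero_le_one _))]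
  refine integral_congr_ae ?_
  filter_upwards [hm.ae_map_potential_policy hmem] with ω h
  rw [condMeanOutcome, ← integral_map hm.measurable_Y.aemeasurable hg.aestronglyMeasurable, ← h,
    integral_map hY.aemeasurable hg.aestronglyMeasurable]

end IsProbabilityMeasure

lemma condMean_varIntegrand (hm : m.Assumptions P) (c : ℝ) {x : EuclideanSpace ℝ (Fin d)}
    (hY : ∀ᵐ ω ∂(m.condP (π x, x)), m.Y ω ∈ m.𝒴) :
    m.condMean π (m.varIntegrand π α c) x
      = m.condMeanOutcome (expLoss α c) (π x) x / m.fA (π x) x := by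
  rw [condMean, condMeanOutcome, ← integral_div]
  refine integral_congr_ae ?_
  filter_upwards [hY] with ω h
  rw [varIntegrand, expLoss_of_nonneg α c (hm.nonneg_of_mem_outcome h)]

lemma ae_condP_policy_mem (hm : m.Assumptions P) (hmem : ∀ᵐ ω ∂P, π (m.X ω) ∈ m.𝒜) :
    ∀ᵐ ω ∂P, ∀ᵐ ω' ∂(m.condP (π (m.X ω), m.X ω)), m.Y ω' ∈ m.𝒴 := by
  filter_upwards [hmem, hm.ae_density] with ω h1 h2 using hm.ae_mem_outcome (h2 _ h1)

lemma condMeanOutcome_one (hm : m.Assumptions P) (a : ℝ) (x : EuclideanSpace ℝ (Fin d)) :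
    m.condMeanOutcome (fun _ => 1) a x = 1 := by
  have := hm.markov_condP
  simp [condMeanOutcome]

lemma iterMean_varIntegrand (hm : m.Assumptions P)
    (hπ𝒜 : ∃ δ > 0, ∀ᵐ ω ∂P, Metric.ball (π (m.X ω)) δ ⊆ m.𝒜) (c : ℝ) :
    m.iterMean P π (m.varIntegrand π α c)
      = ∫ ω, m.condMeanOutcome (expLoss α c) (π (m.X ω)) (m.X ω)
        / m.fA (π (m.X ω)) (m.X ω) ∂P := by
  refine integral_congr_ae ?_
  filter_upwards [hm.ae_condP_policy_mem (ae_policy_mem hπ𝒜)] with ω hω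
  exact hm.condMean_varIntegrand c hω

/-- Integrating the score-type quotient against the outcome density cancels its denominator. -/
lemma ae_condMean_biasIntegrand (hm : m.Assumptions P)
    (hπ𝒜 : ∃ δ > 0, ∀ᵐ ω ∂P, Metric.ball (π (m.X ω)) δ ⊆ m.𝒜)
    (hquot : ∀ᵐ ω ∂P, ∀ᵐ y ∂(volume.restrict m.𝒴), m.fY y (π (m.X ω)) (m.X ω) = 0 →
      iteratedDeriv 2 (fun a => m.fY y a (m.X ω)) (π (m.X ω)) = 0) (hα : 0 < α) :
    ∀ᵐ ω ∂P, Integrable (fun ω' => m.biasIntegrand π α (m.X ω) (m.Y ω'))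
        (m.condP (π (m.X ω), m.X ω)) ∧
      m.condMean π (m.biasIntegrand π α) (m.X ω)
        = m.integralDeriv2 (expLoss α 1) (π (m.X ω)) (m.X ω) := by
  have hfin := hm.isFiniteMeasure_restrict_outcome
  have hmem := ae_policy_mem hπ𝒜
  obtain ⟨δ, hδ, hball⟩ := hπ𝒜
  obtain ⟨C, hC⟩ := hm.smooth_fY
  filter_upwards [hquot, hball, hmem, hm.ae_density,
    ae_of_ae_map hm.measurable_X.aemeasurable hC] with ω hq hb hp hd hs
  have hd2 := hm.aestronglyMeasurable_deriv2 hs hδ hb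
  have hG : AEStronglyMeasurable (m.biasIntegrand π α (m.X ω)) (volume.restrict m.𝒴) := by
    have h1 : Measurable fun y : ℝ => Real.exp (-y / α) := by fun_prop
    exact h1.aestronglyMeasurable.mul
      (hd2.aemeasurable.div (hm.measurable_fY_left _ _).aemeasurable).aestronglyMeasurable
  have heq : (fun y => m.fY y (π (m.X ω)) (m.X ω) * m.biasIntegrand π α (m.X ω) y)
      =ᵐ[volume.restrict m.𝒴] fun y =>
        expLoss α 1 y * iteratedDeriv 2 (fun a => m.fY y a (m.X ω)) (π (m.X ω)) := by
    filter_upwards [hq, ae_restrict_mem hm.measurableSet_𝒴] with y hy hy𝒴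
    rw [biasIntegrand, expLoss_one_of_nonneg α (hm.nonneg_of_mem_outcome hy𝒴)]
    by_cases h0 : m.fY y (π (m.X ω)) (m.X ω) = 0
    · rw [h0, hy h0]; ring
    · field_simp
  constructor
  · rw [hm.integrable_condP_iff (hd _ hp) hG]
    refine Integrable.congr (.of_bound ((measurable_expLoss α 1).aestronglyMeasurable.mul hd2)
      (1 * C) ?_) heq.symm
    refine ae_restrict_of_forall_mem hm.measurableSet_𝒴 fun y hy => ?_
    have h1 := (hs y hy).abs_iteratedDeriv_le hb (t := 0) (by simpa using hδ) (k := 2)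
      (by norm_num)
    rw [add_zero] at h1
    rw [Pi.mul_apply, Real.norm_eq_abs, abs_mul]
    exact mul_le_mul (abs_expLoss_le hα zero_le_one y) h1 (abs_nonneg _) zero_le_one
  · rw [condMean, hm.integral_condP_eq (hd _ hp) hG]
    exact integral_congr_ae heq

section IsProbabilityMeasure

variable [IsProbabilityMeasure P]

lemma integrable_condMeanOutcome_div (hm : m.Assumptions P) (hπ : Measurable π)
    (hπ𝒜 : ∃ δ > 0, ∀ᵐ ω ∂P, Metric.ball (π (m.X ω)) δ ⊆ m.𝒜) {ψ : ℝ → ℝ} (hψ : Measurable ψ)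
    {B : ℝ} (hB : ∀ y, |ψ y| ≤ B) :
    Integrable (fun ω => m.condMeanOutcome ψ (π (m.X ω)) (m.X ω) / m.fA (π (m.X ω)) (m.X ω)) P := by
  obtain ⟨ε, hε, -, -, hpol⟩ := hm.exists_ae_fA_policy hπ𝒜
  have h1 := hm.measurable_condMeanOutcome_policy hπ hψ 0
  simp only [add_zero] at h1
  have h2 : Measurable fun ω => m.fA (π (m.X ω)) (m.X ω) :=
    hm.measurable_fA.comp ((hπ.comp hm.measurable_X).prodMk hm.measurable_X)
  refine .of_bound (h1.div h2).aestronglyMeasurable (B / ε) ?_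
  filter_upwards [hpol] with ω hω
  have hB0 : 0 ≤ B := (abs_nonneg _).trans (hB 0)
  rw [Real.norm_eq_abs, abs_div, abs_of_pos (hε.trans_le hω.1)]
  gcongr
  exacts [hm.abs_condMeanOutcome_le hB _ _, hω.1]

lemma integrable_one_div_fA (hm : m.Assumptions P) (hπ : Measurable π)
    (hπ𝒜 : ∃ δ > 0, ∀ᵐ ω ∂P, Metric.ball (π (m.X ω)) δ ⊆ m.𝒜) :
    Integrable (fun ω => 1 / m.fA (π (m.X ω)) (m.X ω)) P := by
  simpa only [hm.condMeanOutcome_one] using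
    hm.integrable_condMeanOutcome_div hπ hπ𝒜 (ψ := fun _ => 1) measurable_const (B := 1) (by simp)

lemma iterIntegrable_varIntegrand (hm : m.Assumptions P) (hπ : Measurable π)
    (hπ𝒜 : ∃ δ > 0, ∀ᵐ ω ∂P, Metric.ball (π (m.X ω)) δ ⊆ m.𝒜) (hα : 0 < α) {c : ℝ}
    (hc : 0 ≤ c) : m.IterIntegrable P π (m.varIntegrand π α c) := by
  have := hm.markov_condP
  have hY := hm.ae_condP_policy_mem (ae_policy_mem hπ𝒜)
  have hYm := hm.measurable_Y
  constructor
  · filter_upwards [hY] with ω hω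
    refine Integrable.div_const (.of_bound (by fun_prop) 1 ?_) _
    filter_upwards [hω] with ω' h
    rw [← expLoss_of_nonneg α c (hm.nonneg_of_mem_outcome h)]
    exact abs_expLoss_le hα hc _
  · refine (hm.integrable_condMeanOutcome_div hπ hπ𝒜 (measurable_expLoss α c)
      (abs_expLoss_le hα hc)).congr ?_
    filter_upwards [hY] with ω hω
    rw [hm.condMean_varIntegrand c hω]

/-- The asymptotic variance is a weighted second moment of the centered outcome. -/
lemma asymVar_eq (hm : m.Assumptions P) (hπ : Measurable π)
    (hπ𝒜 : ∃ δ > 0, ∀ᵐ ω ∂P, Metric.ball (π (m.X ω)) δ ⊆ m.𝒜) (hα : 0 < α) :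
    m.asymVar P K π α = (∫ u, K u ^ 2) *
      ∫ ω, m.condMeanOutcome (fun y => (expLoss α 1 y - m.target P π α) ^ 2) (π (m.X ω)) (m.X ω)
        / m.fA (π (m.X ω)) (m.X ω) ∂P := by
  have := hm.markov_condP
  have hYm := hm.measurable_Y
  set θ := m.target P π α
  have hg (c : ℝ) (hc : 0 ≤ c) (z : ℝ × EuclideanSpace ℝ (Fin d)) :
      Integrable (fun ω => expLoss α c (m.Y ω)) (m.condP z) :=
    .of_bound ((measurable_expLoss α c).comp hYm).aestronglyMeasurable 1
      (ae_of_all _ fun ω => abs_expLoss_le hα hc _)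
  have hν a x : m.condMeanOutcome (fun y => (expLoss α 1 y - θ) ^ 2) a x
      = m.condMeanOutcome (expLoss α 2) a x + θ ^ 2
        - 2 * θ * m.condMeanOutcome (expLoss α 1) a x := by
    have e y : (expLoss α 1 y - θ) ^ 2 = expLoss α 2 y + θ ^ 2 - 2 * θ * expLoss α 1 y := by
      rw [expLoss_two]; ring
    have i2 := hg 2 zero_le_two (a, x)
    have i1 := hg 1 zero_le_one (a, x)
    simp only [condMeanOutcome, e]
    have i3 : Integrable (fun ω => expLoss α 2 (m.Y ω) + θ ^ 2) (m.condP (a, x)) :=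
      i2.add (integrable_const _)
    rw [integral_sub i3 (i1.const_mul _),
      integral_add i2 (integrable_const _), integral_const_mul]
    simp
  have j1 := hm.integrable_condMeanOutcome_div hπ hπ𝒜 (measurable_expLoss α 1)
    (abs_expLoss_le hα zero_le_one)
  have j2 := hm.integrable_condMeanOutcome_div hπ hπ𝒜 (measurable_expLoss α 2)
    (abs_expLoss_le hα zero_le_two)
  have j0 := hm.integrable_one_div_fA hπ hπ𝒜
  rw [asymVar, hm.iterMean_varIntegrand hπ𝒜, hm.iterMean_varIntegrand hπ𝒜]
  congr 1
  have e ω : m.condMeanOutcome (fun y => (expLoss α 1 y - θ) ^ 2) (π (m.X ω)) (m.X ω)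
        / m.fA (π (m.X ω)) (m.X ω)
      = m.condMeanOutcome (expLoss α 2) (π (m.X ω)) (m.X ω) / m.fA (π (m.X ω)) (m.X ω)
        + 1 / m.fA (π (m.X ω)) (m.X ω) * θ ^ 2
        - 2 * θ * (m.condMeanOutcome (expLoss α 1) (π (m.X ω)) (m.X ω)
          / m.fA (π (m.X ω)) (m.X ω)) := by
    rw [hν]; ring
  simp only [e]
  have j3 : Integrable (fun ω => m.condMeanOutcome (expLoss α 2) (π (m.X ω)) (m.X ω)
      / m.fA (π (m.X ω)) (m.X ω) + 1 / m.fA (π (m.X ω)) (m.X ω) * θ ^ 2) P :=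
    j2.add (j0.mul_const _)
  rw [integral_sub j3 (j1.const_mul _), integral_add j2 (j0.mul_const _),
    integral_mul_const, integral_const_mul]
  ring

lemma asymVar_nonneg (hm : m.Assumptions P) (hπ : Measurable π)
    (hπ𝒜 : ∃ δ > 0, ∀ᵐ ω ∂P, Metric.ball (π (m.X ω)) δ ⊆ m.𝒜) (hα : 0 < α) :
    0 ≤ m.asymVar P K π α := by
  rw [hm.asymVar_eq hπ hπ𝒜 hα]
  exact mul_nonneg (integral_nonneg fun u => sq_nonneg _) (integral_nonneg fun ω =>
    div_nonneg (integral_nonneg fun ω' => sq_nonneg _) (hm.fA_nonneg _ _))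

end IsProbabilityMeasure

end Assumptions

end CausalModel

/-! ### Limits of the numerator and the denominator -/

namespace CausalModel

namespace Assumptions

variable {Ω : Type*} [MeasurableSpace Ω] {d : ℕ} {m : CausalModel Ω d} {P : Measure Ω}
  {π : EuclideanSpace ℝ (Fin d) → ℝ} {K : ℝ → ℝ} {α : ℝ}

lemma iterMean_biasIntegrand (hm : m.Assumptions P)
    (hπ𝒜 : ∃ δ > 0, ∀ᵐ ω ∂P, Metric.ball (π (m.X ω)) δ ⊆ m.𝒜)
    (hquot : ∀ᵐ ω ∂P, ∀ᵐ y ∂(volume.restrict m.𝒴), m.fY y (π (m.X ω)) (m.X ω) = 0 →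
      iteratedDeriv 2 (fun a => m.fY y a (m.X ω)) (π (m.X ω)) = 0) (hα : 0 < α) :
    m.iterMean P π (m.biasIntegrand π α)
      = ∫ ω, m.integralDeriv2 (expLoss α 1) (π (m.X ω)) (m.X ω) ∂P :=
  integral_congr_ae ((hm.ae_condMean_biasIntegrand hπ𝒜 hquot hα).mono fun _ h => h.2)

variable [IsProbabilityMeasure P]

lemma integrable_weight_pow_mul (hm : m.Assumptions P) (hK : IsSecondOrderKernel K)
    (hπ : Measurable π) {ψ : ℝ → ℝ} (hψ : Measurable ψ) {B : ℝ} (hB : ∀ y, |ψ y| ≤ B) {h : ℝ}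
    (hh : 0 < h) (k : ℕ) :
    Integrable (fun ω => m.weight K π h (m.X ω) (m.A ω) ^ k * ψ (m.Y ω)) P := by
  obtain ⟨c, hc, hb⟩ := hm.exists_ae_abs_weight_le (π := π) hK
  have h1 : Measurable fun ω => m.weight K π h (m.X ω) (m.A ω) :=
    (hm.measurable_weight hK hπ h).comp (hm.measurable_X.prodMk hm.measurable_A)
  refine .of_bound ((h1.pow_const k).mul (hψ.comp hm.measurable_Y)).aestronglyMeasurable
    ((c / h) ^ k * B) ?_
  filter_upwards [hb h hh] with ω hω
  rw [Real.norm_eq_abs, abs_mul, abs_pow]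
  gcongr
  exact hB _

lemma integrable_weight_mul (hm : m.Assumptions P) (hK : IsSecondOrderKernel K)
    (hπ : Measurable π) {ψ : ℝ → ℝ} (hψ : Measurable ψ) {B : ℝ} (hB : ∀ y, |ψ y| ≤ B) {h : ℝ}
    (hh : 0 < h) : Integrable (fun ω => m.weight K π h (m.X ω) (m.A ω) * ψ (m.Y ω)) P := by
  simpa only [pow_one] using hm.integrable_weight_pow_mul hK hπ hψ hB hh 1

lemma integrable_weight_pow (hm : m.Assumptions P) (hK : IsSecondOrderKernel K)
    (hπ : Measurable π) {h : ℝ} (hh : 0 < h) (k : ℕ) :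
    Integrable (fun ω => m.weight K π h (m.X ω) (m.A ω) ^ k) P := by
  simpa only [mul_one] using hm.integrable_weight_pow_mul hK hπ (ψ := fun _ => 1)
    measurable_const (B := 1) (by simp) hh k

lemma integrable_weight (hm : m.Assumptions P) (hK : IsSecondOrderKernel K)
    (hπ : Measurable π) {h : ℝ} (hh : 0 < h) :
    Integrable (fun ω => m.weight K π h (m.X ω) (m.A ω)) P := by
  simpa only [pow_one] using hm.integrable_weight_pow hK hπ hh 1

lemma exists_abs_integral_weight_sub_one_le (hm : m.Assumptions P) (hK : IsSecondOrderKernel K)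
    (hπ : Measurable π) (hπ𝒜 : ∃ δ > 0, ∀ᵐ ω ∂P, Metric.ball (π (m.X ω)) δ ⊆ m.𝒜) :
    ∃ c, ∀ h > 0, |(∫ ω, m.weight K π h (m.X ω) (m.A ω) ∂P) - 1|
      ≤ h ^ 2 * (c * smoothingRemainder K h) := by
  obtain ⟨c, hc⟩ := hm.exists_abs_integral_weight_sub_le hK hπ hπ𝒜 (ψ := fun _ => 1)
    measurable_const (B := 1) (by simp)
  refine ⟨c, fun h hh => ?_⟩
  have := hc h hh
  rw [integral_congr_ae (hm.ae_integralDeriv2_one hπ𝒜)] at this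
  simpa only [hm.condMeanOutcome_one, mul_one, integral_zero, mul_zero, add_zero,
    integral_const, probReal_univ, smul_eq_mul] using this

/-- The bias of the numerator of the estimation error. -/
lemma exists_abs_integral_weight_loss_sub_le (hm : m.Assumptions P) (hK : IsSecondOrderKernel K)
    (hπ : Measurable π) (hπ𝒜 : ∃ δ > 0, ∀ᵐ ω ∂P, Metric.ball (π (m.X ω)) δ ⊆ m.𝒜)
    (hquot : ∀ᵐ ω ∂P, ∀ᵐ y ∂(volume.restrict m.𝒴), m.fY y (π (m.X ω)) (m.X ω) = 0 →
      iteratedDeriv 2 (fun a => m.fY y a (m.X ω)) (π (m.X ω)) = 0) (hα : 0 < α) :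
    ∃ c, ∀ h > 0, |(∫ ω, m.weight K π h (m.X ω) (m.A ω)
        * (expLoss α 1 (m.Y ω) - m.target P π α) ∂P) - m.bias P K π α * h ^ 2|
      ≤ h ^ 2 * (c * smoothingRemainder K h) := by
  have hg := measurable_expLoss α 1
  have hgb := abs_expLoss_le hα zero_le_one
  obtain ⟨c₁, h₁⟩ := hm.exists_abs_integral_weight_sub_le hK hπ hπ𝒜 hg hgb
  obtain ⟨c₂, h₂⟩ := hm.exists_abs_integral_weight_sub_one_le hK hπ hπ𝒜
  have hθ := hm.target_eq hπ (ae_policy_mem hπ𝒜) hα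
  set θ := m.target P π α
  refine ⟨c₁ + |θ| * c₂, fun h hh => ?_⟩
  have b₁ := h₁ h hh
  have b₂ := h₂ h hh
  rw [← hθ, ← hm.iterMean_biasIntegrand hπ𝒜 hquot hα] at b₁
  have e : (∫ ω, m.weight K π h (m.X ω) (m.A ω) * (expLoss α 1 (m.Y ω) - θ) ∂P)
      = (∫ ω, m.weight K π h (m.X ω) (m.A ω) * expLoss α 1 (m.Y ω) ∂P)
        - (∫ ω, m.weight K π h (m.X ω) (m.A ω) ∂P) * θ := by
    simp only [mul_sub]
    rw [integral_sub (hm.integrable_weight_mul hK hπ hg hgb hh)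
      ((hm.integrable_weight hK hπ hh).mul_const θ), integral_mul_const]
  have e' : (∫ ω, m.weight K π h (m.X ω) (m.A ω) * expLoss α 1 (m.Y ω) ∂P)
        - (∫ ω, m.weight K π h (m.X ω) (m.A ω) ∂P) * θ - m.bias P K π α * h ^ 2
      = ((∫ ω, m.weight K π h (m.X ω) (m.A ω) * expLoss α 1 (m.Y ω) ∂P)
          - (θ + h ^ 2 * ((∫ u, u ^ 2 * K u) / 2 * m.iterMean P π (m.biasIntegrand π α))))
        - θ * ((∫ ω, m.weight K π h (m.X ω) (m.A ω) ∂P) - 1) := by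
    rw [bias]; ring
  rw [e, e']
  refine (abs_sub _ _).trans ?_
  rw [abs_mul]
  calc _ ≤ h ^ 2 * (c₁ * smoothingRemainder K h)
        + |θ| * (h ^ 2 * (c₂ * smoothingRemainder K h)) := by gcongr
    _ = _ := by ring

section Sample

variable {Ω' : Type*} [MeasurableSpace Ω'] {P' : Measure Ω'} [IsProbabilityMeasure P']
  {Xs : ℕ → Ω' → EuclideanSpace ℝ (Fin d)} {As Ys : ℕ → Ω' → ℝ} {h : ℕ → ℝ}

/-- The normalization factor converges to `1` in probability. -/
lemma tendstoInMeasure_S (hm : m.Assumptions P) (hK : IsSecondOrderKernel K)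
    (hπ : Measurable π) (hπ𝒜 : ∃ δ > 0, ∀ᵐ ω ∂P, Metric.ball (π (m.X ω)) δ ⊆ m.𝒜)
    (hindep : iIndepFun (fun i ω => (Xs i ω, As i ω, Ys i ω)) P')
    (hident : ∀ i, IdentDistrib (fun ω => (Xs i ω, As i ω, Ys i ω))
      (fun ω => (m.X ω, m.A ω, m.Y ω)) P' P)
    (h_pos : ∀ N, 0 < h N) (h_zero : Tendsto h atTop (𝓝 0))
    (h_top : Tendsto (fun N : ℕ => (N : ℝ) * h N) atTop atTop) :
    TendstoInMeasure P' (fun N ω => m.S K π (h N) N (fun i => Xs i ω) (fun i => As i ω))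
      atTop (fun _ => 1) := by
  obtain ⟨c, hc, hwb⟩ := hm.exists_ae_abs_weight_le (π := π) hK
  obtain ⟨c₂, h₂⟩ := hm.exists_abs_integral_weight_sub_one_le hK hπ hπ𝒜
  have hR := hK.tendsto_smoothingRemainder h_zero
  have hinv : Tendsto (fun N : ℕ => ((N : ℝ) * h N)⁻¹) atTop (𝓝 0) :=
    tendsto_inv_atTop_zero.comp h_top
  have hNinv : Tendsto (fun N : ℕ => (1 : ℝ) / N) atTop (𝓝 0) := tendsto_one_div_atTop_nhds_zero_nat
  have hmean : Tendsto (fun N => (∫ ω, m.weight K π (h N) (m.X ω) (m.A ω) ∂P) - 1) atTop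
      (𝓝 0) := by
    have : Tendsto (fun N => h N ^ 2 * (c₂ * smoothingRemainder K (h N))) atTop (𝓝 0) := by
      simpa using (h_zero.pow 2).mul (hR.const_mul c₂)
    exact squeeze_zero_norm (fun N => h₂ _ (h_pos N)) this
  have hsq : Tendsto (fun N : ℕ => ((N : ℝ) * h N)⁻¹
        * (h N * ∫ ω, m.weight K π (h N) (m.X ω) (m.A ω) ^ 2 ∂P)
        - (1 : ℝ) / N * (2 * ((∫ ω, m.weight K π (h N) (m.X ω) (m.A ω) ∂P) - 1) + 1)) atTop
      (𝓝 0) := by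
    have h3 := hm.tendsto_mul_integral_weight_sq hK hπ hπ𝒜 (ψ := fun _ => 1) measurable_const
      (B := 1) (by simp) h_pos h_zero
    simp only [mul_one] at h3
    simpa using (hinv.mul h3).sub (hNinv.mul ((hmean.const_mul 2).add_const 1))
  -- The centered mean of the weights, as a row of the array with limiting variance `0`.
  have hclt := tendstoInDistribution_sum_of_bounded_rows (P := P) (P' := P') (v := 0)
    (V := fun ω => (m.X ω, m.A ω, m.Y ω)) (W := fun i ω => (Xs i ω, As i ω, Ys i ω))
    (ξ := fun (N : ℕ) z => 1 / (N : ℝ) * (m.weight K π (h N) z.1 z.2.1 - 1))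
    (e := fun N : ℕ => c * ((N : ℝ) * h N)⁻¹ + 1 / N) hindep hident
    (fun N => by
      have := hm.measurable_weight hK hπ (h N)
      exact ((this.comp (measurable_fst.prodMk (measurable_fst.comp measurable_snd))).sub_const
        1).const_mul _)
    (by simpa using (hinv.const_mul c).add hNinv)
    (fun N => by
      filter_upwards [hwb _ (h_pos N)] with ω hω
      rw [abs_mul, abs_of_nonneg (by positivity : (0 : ℝ) ≤ 1 / N)]
      calc _ ≤ 1 / (N : ℝ) * (c / h N + 1) := by
            gcongr
            exact (abs_sub _ _).trans (by rw [abs_one]; gcongr)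
        _ = _ := by rw [mul_inv]; ring)
    (by
      refine hmean.congr' ?_
      filter_upwards [eventually_ne_atTop 0] with N hN
      have hN' : (N : ℝ) ≠ 0 := Nat.cast_ne_zero.2 hN
      rw [integral_const_mul, ← mul_assoc, mul_one_div_cancel hN', one_mul,
        integral_sub (hm.integrable_weight hK hπ (h_pos N)) (integrable_const _)]
      simp)
    (by
      refine hsq.congr' ?_
      filter_upwards [eventually_ne_atTop 0] with N hN
      have hN' : (N : ℝ) ≠ 0 := Nat.cast_ne_zero.2 hN
      have hh := (h_pos N).ne'
      have i1 := hm.integrable_weight hK hπ (h_pos N)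
      have i2 := hm.integrable_weight_pow hK hπ (h_pos N) 2
      have e ω : (1 / (N : ℝ) * (m.weight K π (h N) (m.X ω) (m.A ω) - 1)) ^ 2
          = 1 / (N : ℝ) ^ 2 * (m.weight K π (h N) (m.X ω) (m.A ω) ^ 2
            - 2 * m.weight K π (h N) (m.X ω) (m.A ω) + 1) := by ring
      have i3 : Integrable (fun ω => m.weight K π (h N) (m.X ω) (m.A ω) ^ 2
        - 2 * m.weight K π (h N) (m.X ω) (m.A ω)) P := i2.sub (i1.const_mul 2)
      simp only [e]
      rw [integral_const_mul, integral_add i3 (integrable_const _),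
        integral_sub i2 (i1.const_mul 2), integral_const_mul]
      simp only [integral_const, probReal_univ, smul_eq_mul, mul_one]
      field_simp
      ring)
  have hmeas := tendstoInMeasure_of_tendstoInDistribution_zero hclt
  rw [tendstoInMeasure_iff_norm] at hmeas ⊢
  intro ε hε
  refine (hmeas ε hε).congr' ?_
  filter_upwards [eventually_ne_atTop 0] with N hN
  have hN' : (N : ℝ) ≠ 0 := Nat.cast_ne_zero.2 hN
  have e ω : ∑ i ∈ Finset.range N, 1 / (N : ℝ) * (m.weight K π (h N) (Xs i ω) (As i ω) - 1)
      = m.S K π (h N) N (fun i => Xs i ω) (fun i => As i ω) - 1 := by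
    rw [S, ← Finset.mul_sum, Finset.sum_sub_distrib]
    simp only [Finset.sum_const, Finset.card_range, nsmul_eq_mul, mul_one, mul_sub]
    rw [one_div_mul_cancel hN']
  simp only [e, sub_zero]

/-- The central limit theorem for the linearized estimation error. Subtracting the bias inside the
weighted sum makes this sum exactly the estimation error times the normalization factor. -/
lemma tendstoInDistribution_numerator (hm : m.Assumptions P) (hK : IsSecondOrderKernel K)
    (hπ : Measurable π) (hπ𝒜 : ∃ δ > 0, ∀ᵐ ω ∂P, Metric.ball (π (m.X ω)) δ ⊆ m.𝒜)
    (hquot : ∀ᵐ ω ∂P, ∀ᵐ y ∂(volume.restrict m.𝒴), m.fY y (π (m.X ω)) (m.X ω) = 0 →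
      iteratedDeriv 2 (fun a => m.fY y a (m.X ω)) (π (m.X ω)) = 0) (hα : 0 < α)
    (hindep : iIndepFun (fun i ω => (Xs i ω, As i ω, Ys i ω)) P')
    (hident : ∀ i, IdentDistrib (fun ω => (Xs i ω, As i ω, Ys i ω))
      (fun ω => (m.X ω, m.A ω, m.Y ω)) P' P)
    (h_pos : ∀ N, 0 < h N) (h_zero : Tendsto h atTop (𝓝 0))
    (h_top : Tendsto (fun N : ℕ => (N : ℝ) * h N) atTop atTop)
    {C : ℝ} (h_five : Tendsto (fun N : ℕ => (N : ℝ) * h N ^ 5) atTop (𝓝 C)) :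
    TendstoInDistribution (fun (N : ℕ) ω => ∑ i ∈ Finset.range N, √((N : ℝ) * h N) / N *
        (m.weight K π (h N) (Xs i ω) (As i ω) *
          (expLoss α 1 (Ys i ω) - m.target P π α - m.bias P K π α * h N ^ 2)))
      atTop id (fun _ => P') (gaussianReal 0 (m.asymVar P K π α).toNNReal) := by
  obtain ⟨c, hc, hwb⟩ := hm.exists_ae_abs_weight_le (π := π) hK
  obtain ⟨c₁, h₁⟩ := hm.exists_abs_integral_weight_loss_sub_le hK hπ hπ𝒜 hquot hα
  obtain ⟨c₂, h₂⟩ := hm.exists_abs_integral_weight_sub_one_le hK hπ hπ𝒜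
  have hR := hK.tendsto_smoothingRemainder h_zero
  have hg := measurable_expLoss α 1
  have hgb := abs_expLoss_le hα zero_le_one
  have hV := hm.asymVar_eq (K := K) hπ hπ𝒜 hα
  set θ := m.target P π α
  set b := m.bias P K π α
  have hψ : Measurable fun y => expLoss α 1 y - θ := hg.sub_const θ
  have hψb y : |expLoss α 1 y - θ| ≤ 1 + |θ| := (abs_sub _ _).trans (by gcongr; exact hgb y)
  have hψ2 : Measurable fun y => (expLoss α 1 y - θ) ^ 2 := hψ.pow_const 2
  have hψ2b y : |(expLoss α 1 y - θ) ^ 2| ≤ (1 + |θ|) ^ 2 := by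
    rw [abs_pow]
    gcongr
    exact hψb y
  refine tendstoInDistribution_sum_of_bounded_rows (P := P) (P' := P')
    (V := fun ω => (m.X ω, m.A ω, m.Y ω)) (W := fun i ω => (Xs i ω, As i ω, Ys i ω))
    (ξ := fun (N : ℕ) z => √((N : ℝ) * h N) / N * (m.weight K π (h N) z.1 z.2.1 *
      (expLoss α 1 z.2.2 - θ - b * h N ^ 2)))
    (e := fun N : ℕ => c * (1 + |θ| + |b| * h N ^ 2) * (√((N : ℝ) * h N))⁻¹)
    hindep hident (fun N => ?_) ?_ (fun N => ?_) ?_ ?_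
  · have := hm.measurable_weight hK hπ (h N)
    exact ((this.comp (measurable_fst.prodMk (measurable_fst.comp measurable_snd))).mul
      ((hψ.comp (measurable_snd.comp measurable_snd)).sub_const _)).const_mul _
  · have h3 : Tendsto (fun N : ℕ => (√((N : ℝ) * h N))⁻¹) atTop (𝓝 0) :=
      tendsto_inv_atTop_zero.comp (Real.tendsto_sqrt_atTop.comp h_top)
    simpa using ((((h_zero.pow 2).const_mul |b|).const_add (1 + |θ|)).const_mul c).mul h3
  · filter_upwards [hwb _ (h_pos N)] with ω hω
    have hh := h_pos N
    rw [abs_mul, abs_mul, abs_of_nonneg (by positivity : 0 ≤ √((N : ℝ) * h N) / N)]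
    have h3 : |expLoss α 1 (m.Y ω) - θ - b * h N ^ 2| ≤ 1 + |θ| + |b| * h N ^ 2 := by
      refine (abs_sub _ _).trans ?_
      rw [abs_mul, abs_of_nonneg (sq_nonneg (h N))]
      gcongr
      exact hψb _
    calc _ ≤ √((N : ℝ) * h N) / N * (c / h N * (1 + |θ| + |b| * h N ^ 2)) := by gcongr
      _ = c * (1 + |θ| + |b| * h N ^ 2) * (√((N : ℝ) * h N) / (N * h N)) := by ring
      _ = _ := by rw [Real.sqrt_div_self']; simp
  · have hbd : Tendsto (fun N : ℕ => √((N : ℝ) * h N ^ 5) * (c₁ * smoothingRemainder K (h N)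
        + |b| * (h N ^ 2 * (c₂ * smoothingRemainder K (h N))))) atTop (𝓝 0) := by
      have := ((Real.continuous_sqrt.tendsto _).comp h_five).mul ((hR.const_mul c₁).add
        (((h_zero.pow 2).mul (hR.const_mul c₂)).const_mul |b|))
      simpa using this
    refine squeeze_zero_norm' ?_ hbd
    filter_upwards [eventually_ne_atTop 0] with N hN
    have hN' : (N : ℝ) ≠ 0 := Nat.cast_ne_zero.2 hN
    have hh := h_pos N
    have b₁ := h₁ _ hh
    have b₂ := h₂ _ hh
    have i1 := hm.integrable_weight_mul hK hπ hψ hψb hh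
    have i2 := (hm.integrable_weight hK hπ hh).mul_const (b * h N ^ 2)
    have hs : √((N : ℝ) * h N ^ 5) = √((N : ℝ) * h N) * h N ^ 2 := by
      rw [show (N : ℝ) * h N ^ 5 = (N : ℝ) * h N * (h N ^ 2) ^ 2 by ring,
        Real.sqrt_mul' _ (sq_nonneg _), Real.sqrt_sq (sq_nonneg _)]
    have e : (N : ℝ) * ∫ ω, √((N : ℝ) * h N) / N * (m.weight K π (h N) (m.X ω) (m.A ω) *
          (expLoss α 1 (m.Y ω) - θ - b * h N ^ 2)) ∂P
        = √((N : ℝ) * h N) * (((∫ ω, m.weight K π (h N) (m.X ω) (m.A ω)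
            * (expLoss α 1 (m.Y ω) - θ) ∂P) - b * h N ^ 2)
          - b * h N ^ 2 * ((∫ ω, m.weight K π (h N) (m.X ω) (m.A ω) ∂P) - 1)) := by
      rw [integral_const_mul]
      simp only [mul_sub (m.weight K π (h N) _ _) (expLoss α 1 _ - θ)]
      rw [integral_sub i1 i2, integral_mul_const]
      field_simp
      ring
    rw [e, norm_mul, Real.norm_eq_abs, Real.norm_eq_abs, abs_of_nonneg (Real.sqrt_nonneg _), hs,
      mul_assoc (√((N : ℝ) * h N))]
    refine mul_le_mul_of_nonneg_left ?_ (Real.sqrt_nonneg _)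
    refine (abs_sub _ _).trans ?_
    rw [abs_mul, abs_mul b, abs_of_nonneg (sq_nonneg (h N))]
    calc _ ≤ h N ^ 2 * (c₁ * smoothingRemainder K (h N))
          + |b| * h N ^ 2 * (h N ^ 2 * (c₂ * smoothingRemainder K (h N))) := by gcongr
      _ = _ := by ring
  · have l2 := hm.tendsto_mul_integral_weight_sq hK hπ hπ𝒜 hψ2 hψ2b h_pos h_zero
    have l1 := hm.tendsto_mul_integral_weight_sq hK hπ hπ𝒜 hψ hψb h_pos h_zero
    have l0 := hm.tendsto_mul_integral_weight_sq hK hπ hπ𝒜 (ψ := fun _ => 1) measurable_const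
      (B := 1) (by simp) h_pos h_zero
    simp only [mul_one] at l0
    rw [← hV] at l2
    have hb2 : Tendsto (fun N => b * h N ^ 2) atTop (𝓝 0) := by
      simpa using (h_zero.pow 2).const_mul b
    have hlim := (l2.sub ((hb2.const_mul 2).mul l1)).add ((hb2.pow 2).mul l0)
    simp only [mul_zero, zero_mul, sub_zero, ne_eq, OfNat.ofNat_ne_zero, not_false_eq_true,
      zero_pow, add_zero] at hlim
    refine hlim.congr' ?_
    filter_upwards [eventually_ne_atTop 0] with N hN
    have hN' : (N : ℝ) ≠ 0 := Nat.cast_ne_zero.2 hN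
    have hh := h_pos N
    have i2 := hm.integrable_weight_pow_mul hK hπ hψ2 hψ2b hh 2
    have i1 := (hm.integrable_weight_pow_mul hK hπ hψ hψb hh 2).const_mul (2 * (b * h N ^ 2))
    have i0 := (hm.integrable_weight_pow hK hπ hh 2).const_mul ((b * h N ^ 2) ^ 2)
    have e ω : (√((N : ℝ) * h N) / N * (m.weight K π (h N) (m.X ω) (m.A ω) *
          (expLoss α 1 (m.Y ω) - θ - b * h N ^ 2))) ^ 2
        = h N / N * (m.weight K π (h N) (m.X ω) (m.A ω) ^ 2 * (expLoss α 1 (m.Y ω) - θ) ^ 2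
          - 2 * (b * h N ^ 2)
            * (m.weight K π (h N) (m.X ω) (m.A ω) ^ 2 * (expLoss α 1 (m.Y ω) - θ))
          + (b * h N ^ 2) ^ 2 * m.weight K π (h N) (m.X ω) (m.A ω) ^ 2) := by
      rw [mul_pow, div_pow, Real.sq_sqrt (by positivity)]
      field_simp
      ring
    have i3 : Integrable (fun ω => m.weight K π (h N) (m.X ω) (m.A ω) ^ 2
          * (expLoss α 1 (m.Y ω) - θ) ^ 2 - 2 * (b * h N ^ 2)
            * (m.weight K π (h N) (m.X ω) (m.A ω) ^ 2 * (expLoss α 1 (m.Y ω) - θ))) P :=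
      i2.sub i1
    simp only [e]
    rw [integral_const_mul, integral_add i3 i0, integral_sub i2 i1, integral_const_mul,
      integral_const_mul]
    field_simp

end Sample

end Assumptions

end CausalModel

/-! ### The self-normalized estimator -/

/-- Division of an asymptotically normal sequence by a sequence converging to `1` in probability.
Where the denominators vanish the quotients are `0`; this happens with vanishing probability. -/
lemma tendstoInDistribution_of_eq_div {Ω Ω' : Type*} [MeasurableSpace Ω]
    [MeasurableSpace Ω'] {P : Measure Ω} [IsProbabilityMeasure P] {P' : Measure Ω'}
    [IsProbabilityMeasure P'] {Z : Ω → ℝ} {G S R : ℕ → Ω' → ℝ}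
    (hG : TendstoInDistribution G atTop Z (fun _ => P') P)
    (hS : TendstoInMeasure P' S atTop fun _ => 1) (hSm : ∀ N, AEMeasurable (S N) P')
    (hRm : ∀ N, AEMeasurable (R N) P') (hR : ∀ N, ∀ᵐ ω ∂P', S N ω ≠ 0 → R N ω = G N ω / S N ω) :
    TendstoInDistribution R atTop Z (fun _ => P') P := by
  have hpos (s : ℝ) : max s (1 / 2) ≠ 0 :=
    (lt_of_lt_of_le (by norm_num : (0 : ℝ) < 1 / 2) (le_max_right _ _)).ne'
  -- Truncating the denominator from below makes the quotient a continuous function.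
  have hH := hG.continuous_comp_prodMk_of_tendstoInMeasure_const
    (g := fun p : ℝ × ℝ => p.1 / max p.2 (1 / 2))
    (continuous_fst.div (continuous_snd.max continuous_const) fun p => hpos _) hS hSm
  have hmax : max (1 : ℝ) (1 / 2) = 1 := max_eq_left (by norm_num)
  simp only [hmax, div_one] at hH
  refine tendstoInDistribution_of_tendstoInMeasure_sub R Z hH ?_ hRm
  rw [tendstoInMeasure_iff_norm] at hS ⊢
  intro ε hε
  refine tendsto_of_tendsto_of_tendsto_of_le_of_le tendsto_const_nhds (hS (1 / 2) (by norm_num))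
    (fun _ => zero_le) fun N => ?_
  refine measure_mono_ae ?_
  filter_upwards [hR N] with ω hω hmem
  change ε ≤ ‖R N ω - G N ω / max (S N ω) (1 / 2) - 0‖ at hmem
  change 1 / 2 ≤ ‖S N ω - 1‖
  by_contra! hlt
  rw [Real.norm_eq_abs, abs_lt] at hlt
  have hS2 : 1 / 2 < S N ω := by linarith [hlt.1]
  rw [hω (by linarith : (0 : ℝ) < S N ω).ne', max_eq_left hS2.le, sub_self, sub_zero,
    norm_zero] at hmem
  linarith

theorem theorem1
    {Ω : Type*} [MeasurableSpace Ω] (P : Measure Ω) [IsProbabilityMeasure P]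
    {d : ℕ} (m : CausalModel Ω d) (hm : m.Assumptions P)
    (K : ℝ → ℝ) (hK : IsSecondOrderKernel K)
    (π : EuclideanSpace ℝ (Fin d) → ℝ) (hπ : Measurable π)
    -- the policy stays away from the boundary of the treatment set
    (hπ𝒜 : ∃ δ > 0, ∀ᵐ ω ∂P, Metric.ball (π (m.X ω)) δ ⊆ m.𝒜)
    -- the quotient in the bias coefficient is meaningful (as `0 / 0 = 0` where the density is 0)
    (hquot : ∀ᵐ ω ∂P, ∀ᵐ y ∂(volume.restrict m.𝒴), m.fY y (π (m.X ω)) (m.X ω) = 0 →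
      iteratedDeriv 2 (fun a => m.fY y a (m.X ω)) (π (m.X ω)) = 0)
    (α : ℝ) (hα : 0 < α)
    -- an i.i.d. sample of copies of `(X, A, Y)`
    {Ω' : Type*} [MeasurableSpace Ω'] (P' : Measure Ω') [IsProbabilityMeasure P']
    (Xs : ℕ → Ω' → EuclideanSpace ℝ (Fin d)) (As Ys : ℕ → Ω' → ℝ)
    (hindep : iIndepFun (fun i ω => (Xs i ω, As i ω, Ys i ω)) P')
    (hident : ∀ i, IdentDistrib (fun ω => (Xs i ω, As i ω, Ys i ω))
      (fun ω => (m.X ω, m.A ω, m.Y ω)) P' P)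
    -- the bandwidths
    (h : ℕ → ℝ) (h_pos : ∀ N, 0 < h N) (h_zero : Tendsto h atTop (𝓝 0))
    (h_top : Tendsto (fun N : ℕ => (N : ℝ) * h N) atTop atTop)
    (C : ℝ) (h_five : Tendsto (fun N : ℕ => (N : ℝ) * h N ^ 5) atTop (𝓝 C)) :
    -- the expectations in the bias and the variance exist
    (m.IterIntegrable P π (m.biasIntegrand π α) ∧
      m.IterIntegrable P π (m.varIntegrand π α 1) ∧
      m.IterIntegrable P π (m.varIntegrand π α 2) ∧
      Integrable (fun ω => 1 / m.fA (π (m.X ω)) (m.X ω)) P ∧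
      Integrable (fun ω => Real.exp (-m.Ypot (π (m.X ω)) ω / α)) P) ∧
    0 ≤ m.asymVar P K π α ∧
    TendstoInDistribution
      (fun (N : ℕ) (ω : Ω') =>
        √((N : ℝ) * h N) *
          (m.What K π α (h N) N (fun i => Xs i ω) (fun i => As i ω) (fun i => Ys i ω)
            - m.target P π α - m.bias P K π α * h N ^ 2))
      atTop id (fun _ => P')
      (gaussianReal 0 (m.asymVar P K π α).toNNReal) := by
  have hmem := CausalModel.Assumptions.ae_policy_mem hπ𝒜
  have hbias := hm.ae_condMean_biasIntegrand hπ𝒜 hquot hα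
  refine ⟨⟨⟨hbias.mono fun _ h => h.1, ?_⟩, hm.iterIntegrable_varIntegrand hπ hπ𝒜 hα zero_le_one,
    hm.iterIntegrable_varIntegrand hπ hπ𝒜 hα zero_le_two, hm.integrable_one_div_fA hπ hπ𝒜,
    hm.integrable_exp_potential hπ hmem hα⟩, hm.asymVar_nonneg hπ hπ𝒜 hα, ?_⟩
  · exact (hm.integrable_integralDeriv2 hπ hπ𝒜 (measurable_expLoss α 1)
      (abs_expLoss_le hα zero_le_one)).congr (hbias.mono fun _ h => h.2.symm)
  have hsample i : AEMeasurable (fun ω => (Xs i ω, As i ω, Ys i ω)) P' :=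
    (hident i).aemeasurable_fst
  have hw N i : AEMeasurable (fun ω => m.weight K π (h N) (Xs i ω) (As i ω)) P' :=
    (hm.measurable_weight hK hπ (h N)).comp_aemeasurable
      ((hsample i).fst.prodMk (hsample i).snd.fst)
  have hY i : AEMeasurable (Ys i) P' := (hsample i).snd.snd
  have hS N : AEMeasurable
      (fun ω => m.S K π (h N) N (fun i => Xs i ω) (fun i => As i ω)) P' :=
    (Finset.aemeasurable_fun_sum _ fun i _ => hw N i).const_mul _
  have hexp : Measurable fun y : ℝ => Real.exp (-y / α) := by fun_prop
  have hW N : AEMeasurable (fun ω =>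
      m.Wbar K π α (h N) N (fun i => Xs i ω) (fun i => As i ω) (fun i => Ys i ω)) P' :=
    (Finset.aemeasurable_fun_sum _ fun i _ =>
      (hw N i).mul (hexp.comp_aemeasurable (hY i))).const_mul _
  refine tendstoInDistribution_of_eq_div
    (hm.tendstoInDistribution_numerator hK hπ hπ𝒜 hquot hα hindep hident h_pos h_zero h_top h_five)
    (hm.tendstoInMeasure_S hK hπ hπ𝒜 hindep hident h_pos h_zero h_top) hS
    (fun N => ((((hW N).div (hS N)).sub_const _).sub_const _).const_mul _) fun N => ?_
  have hmemY : ∀ᵐ ω ∂P', ∀ i, Ys i ω ∈ m.𝒴 := by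
    refine ae_all_iff.2 fun i => ?_
    exact (hident i).symm.ae_snd (p := fun z => z.2.2 ∈ m.𝒴)
      ((measurable_snd.comp measurable_snd) hm.measurableSet_𝒴) hm.outcome_mem
  filter_upwards [hmemY] with ω hω hne
  have hsum : ∑ i ∈ Finset.range N, √((N : ℝ) * h N) / N *
        (m.weight K π (h N) (Xs i ω) (As i ω) *
          (expLoss α 1 (Ys i ω) - m.target P π α - m.bias P K π α * h N ^ 2))
      = √((N : ℝ) * h N) *
        (m.Wbar K π α (h N) N (fun i => Xs i ω) (fun i => As i ω) (fun i => Ys i ω)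
          - (m.target P π α + m.bias P K π α * h N ^ 2)
            * m.S K π (h N) N (fun i => Xs i ω) (fun i => As i ω)) := by
    rw [CausalModel.Wbar, CausalModel.S, Finset.mul_sum, Finset.mul_sum, Finset.mul_sum,
      ← Finset.sum_sub_distrib, Finset.mul_sum]
    refine Finset.sum_congr rfl fun i _ => ?_
    rw [expLoss_one_of_nonneg α (hm.nonneg_of_mem_outcome (hω i))]
    ring
  rw [hsum, CausalModel.What]
  field_simp
  ring
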